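/- **Setting.** Consider a discounted Markov decision process with finite nonempty state and action sets $\mathcal S,\mathcal A$, transition probabilities $P(s'\mid s,a)$, rewards $r(s,a,s')$ with $|r|\le 1$, and discount factor $\gamma\in[0,1)$. For a stationary deterministic policy $\pi:\mathcal S\to\mathcal A$ let $Q^\pi(s,a)$ be the expected discounted sum of rewards when $a$ is taken in $s$ and $\pi$ is followed afterwards, and let $Q^*(s,a)=\max_\pi Q^\pi(s,a)$. Let $d$ be a probability distribution on $\mathcal S\times\mathcal A$ with $d_{\min}:=\min_{s,a}d(s,a)>0$, and let $(s_k,a_k,s_k')_{k\ge0}$ be i.i.d. with $(s_k,a_k)\sim d$ and $s_k'\sim P(\cdot\mid s_k,a_k)$. **Algorithm** (online model-based Q-learning with step size $\alpha\in(0,1]$, confidence parameter $\delta\in(0,1)$ and initial estimate $Q_0$, $\|Q_0\|_\infty\le 1/(1-\gamma)$). For $k\ge 1$ let $\hat P_k(s'\mid s,a)$ be the empirical frequency of $s'$, and $\hat R_k(s,a)$ the average observed reward, over the visits to $(s,a)$ among the first $k$ samples (both are $0$ if there are none). Put $m=\big\lceil \tfrac1{d_{\min}}\ln\tfrac{2|\mathcal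 S||\mathcal A|}{\delta}\big\rceil$. At iteration $k$ the sample $(s_k,a_k,s'_k)$ is observed and the model is updated to $(\hat P_{k+1},\hat R_{k+1})$. In the data-collection stage $k<m$ one sets $Q_{k+1}=Q_k$. In the learning stage $k\ge m$ one sets, for all $(s,a)$, $$Q_{k+1}(s,a)=Q_k(s,a)+\alpha\Big(\hat R_{k+1}(s,a)+\gamma\sum_{s'}\hat P_{k+1}(s'\mid s,a)\max_{u\in\mathcal A}Q_k(s',u)-Q_k(s,a)\Big).$$ **Theorem.** (i) There is a universal constant $C>0$ such that in this setting, for all $\alpha\in(0,1]$, $\varepsilon>0$ and $\delta\in(0,1)$, with probability at least $1-\delta$ one has $\|Q_k-Q^*\|_\infty\le\varepsilon$ simultaneously for all $$k\ \ge\ C\left(\frac{1}{d_{\min}(1-\gamma)^4\varepsilon^2}+\frac1{\alpha(1-\gamma)}\right)\ln\!\left(2+\frac{1}{d_{\min}\,\delta\,(1-\gamma)^2\varepsilon}\right).$$ If $d$ is the uniform distribution on $\mathcal S\times\mathcal A$, then with probability at least $1-\delta$ the same bound holds simultaneously for all $$k\ \ge\ \frac C\alpha\cdot\frac{|\mathcal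 S||\mathcal A|}{(1-\gamma)^4\varepsilon^2}\,\ln\!\left(2+\frac{|\mathcal S||\mathcal A|}{\delta(1-\gamma)^2\varepsilon}\right).$$ That is, for any fixed step size, $\tilde{\mathcal O}\big(\tfrac{|\mathcal S||\mathcal A|}{(1-\gamma)^4\varepsilon^2}\big)$ uniform samples suffice. (ii) This is optimal except for one factor $1/(1-\gamma)$ and logarithms. There is a universal constant $c>0$ such that for all finite $\mathcal S,\mathcal A$ with $|\mathcal S|\ge2$, $|\mathcal A|\ge1$, all $\gamma\in[1/2,1)$, $0<\varepsilon\le c/(1-\gamma)$ and $0<\delta\le1/8$ there is a reward function $r$ with $|r|\le1$ such that the following holds. If a (possibly randomized) estimator, which may know $r$, $\gamma$, $\varepsilon$ and $\delta$, receives $n$ i.i.d. samples $(s,a,s')$ with $(s,a)$ uniform and $s'\sim P(\cdot\mid s,a)$, and for every transition kernel $P$ outputs with probability at least $1-\delta$ a function within $\ell_\infty$-distance $\varepsilon$ of $Q^*$, then $$n\ \ge\ c\,\frac{|\mathcal S||\mathcal A|}{(1-\gamma)^3\varepsilon^2}\,\ln\frac1\delta .$$ -/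

import Mathlib

open MeasureTheory ProbabilityTheory

/-- A finite discounted Markov decision process: transition probabilities `P s a s'`, rewards
`r s a s'` bounded by one in absolute value, and a discount factor `γ ∈ [0, 1)`. -/
structure FiniteMDP (S A : Type*) [Fintype S] where
  P : S → A → S → ℝ
  P_nonneg : ∀ s a s', 0 ≤ P s a s'
  P_sum : ∀ s a, ∑ s', P s a s' = 1
  r : S → A → S → ℝ
  r_bound : ∀ s a s', |r s a s'| ≤ 1
  γ : ℝ
  γ_nonneg : 0 ≤ γ
  γ_lt_one : γ < 1

namespace FiniteMDP

variable {S A : Type*} [Fintype S]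

/-- The expected reward `t` steps ahead, when action `a` is taken in state `s` and the stationary
deterministic policy `π` is followed from the next state on. -/
noncomputable def expReward (M : FiniteMDP S A) (π : S → A) : ℕ → S → A → ℝ
  | 0, s, a => ∑ s', M.P s a s' * M.r s a s'
  | t + 1, s, a => ∑ s', M.P s a s' * M.expReward π t s' (π s')

/-- The Q-function of a policy: the expected discounted sum of rewards. -/
noncomputable def qPolicy (M : FiniteMDP S A) (π : S → A) (x : S × A) : ℝ :=
  ∑' t : ℕ, M.γ ^ t * M.expReward π t x.1 x.2

/-- The optimal Q-function: the best Q-function over all stationary deterministic policies. -/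
noncomputable def qStar (M : FiniteMDP S A) (x : S × A) : ℝ :=
  ⨆ π : S → A, M.qPolicy π x

end FiniteMDP

/-- `N_k(s,a)`: how often `(s,a)` occurs among the first `k` samples. -/
noncomputable def visitCount {S A : Type*} (x : ℕ → S × A × S) (k : ℕ) (s : S) (a : A) : ℕ :=
  open Classical in ((Finset.range k).filter fun i => (x i).1 = s ∧ (x i).2.1 = a).card

/-- `N_k(s,a,s')`: how often the transition `(s,a,s')` occurs among the first `k` samples. -/
noncomputable def transCount {S A : Type*} (x : ℕ → S × A × S) (k : ℕ) (s : S) (a : A) (s' : S) :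
    ℕ :=
  open Classical in ((Finset.range k).filter fun i => x i = (s, a, s')).card

/-- Empirical transition probabilities after `k` samples (zero for a pair not yet visited). -/
noncomputable def empTrans {S A : Type*} (x : ℕ → S × A × S) (k : ℕ) (s : S) (a : A) (s' : S) :
    ℝ :=
  (transCount x k s a s' : ℝ) / (visitCount x k s a : ℝ)

/-- Average of the rewards observed at `(s,a)` in the first `k` samples (zero for a pair not yet
visited). -/
noncomputable def empReward {S A : Type*} (r : S → A → S → ℝ) (x : ℕ → S × A × S) (k : ℕ)
    (s : S) (a : A) : ℝ :=
  (open Classical in ∑ i ∈ (Finset.range k).filter (fun i => (x i).1 = s ∧ (x i).2.1 = a),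
    r (x i).1 (x i).2.1 (x i).2.2) / (visitCount x k s a : ℝ)

/-- The iterates of online model-based Q-learning along the sample stream `x`. At iteration `k` the
sample `x k` is observed and the empirical model is updated with it. For `k < m` (data collection)
the Q-estimate stays put; for `k ≥ m` (learning) every entry of it moves, with step size `α`,
towards the Bellman optimality operator of the current empirical model. -/
noncomputable def mbqIter {S A : Type*} [Fintype S] (M : FiniteMDP S A) (α : ℝ) (m : ℕ)
    (Q₀ : S × A → ℝ) (x : ℕ → S × A × S) : ℕ → S × A → ℝ
  | 0 => Q₀
  | k + 1 =>
    if k < m then mbqIter M α m Q₀ x k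
    else fun y =>
      mbqIter M α m Q₀ x k y
        + α * (empReward M.r x (k + 1) y.1 y.2
            + M.γ * ∑ s', empTrans x (k + 1) y.1 y.2 s' * (⨆ u : A, mbqIter M α m Q₀ x k (s', u))
            - mbqIter M α m Q₀ x k y)

/-- The smallest weight `d_min` of a state-action distribution. -/
noncomputable def dMin {S A : Type*} (d : S × A → ℝ) : ℝ := ⨅ y : S × A, d y

/-- Length `⌈(1 / d_min) ln (2 |S| |A| / δ)⌉` of the data collection stage. -/
noncomputable def collectLen {S A : Type*} [Fintype S] [Fintype A] (d : S × A → ℝ) (δ : ℝ) : ℕ :=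
  ⌈1 / dMin d * Real.log (2 * (Fintype.card S * Fintype.card A : ℝ) / δ)⌉₊

/-- A state-action distribution that gives every pair a positive probability. -/
structure IsExploratory {S A : Type*} [Fintype S] [Fintype A] (d : S × A → ℝ) : Prop where
  pos : ∀ y, 0 < d y
  sum_one : ∑ y, d y = 1

/-- `X 0, X 1, …` are i.i.d. samples `(s, a, s')` with `(s, a) ∼ d` and `s' ∼ P(· | s, a)`. -/
structure IsSampleStream {S A Ω : Type*} [Fintype S] [MeasurableSpace S] [MeasurableSpace A]
    [MeasurableSpace Ω] (M : FiniteMDP S A) (d : S × A → ℝ) (μ : Measure Ω)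
    (X : ℕ → Ω → S × A × S) : Prop where
  measurable : ∀ k, Measurable (X k)
  indep : iIndepFun X μ
  law : ∀ k s a s', μ.real {ω | X k ω = (s, a, s')} = d (s, a) * M.P s a s'

/-- The uniform distribution on state-action pairs. -/
noncomputable def unifDist (S A : Type*) [Fintype S] [Fintype A] : S × A → ℝ :=
  fun _ => 1 / (Fintype.card S * Fintype.card A : ℝ)

/-- Probability that the randomized estimator `est`, given `n` i.i.d. samples `(s, a, s')` with
`(s, a) ∼ d` and `s' ∼ P(· | s, a)`, returns a Q-function within sup-distance `ε` of the optimal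
one. -/
noncomputable def successProb {S A : Type*} [Fintype S] [Fintype A] (M : FiniteMDP S A)
    (d : S × A → ℝ) (n : ℕ) (est : (Fin n → S × A × S) → ProbabilityMeasure (S × A → ℝ))
    (ε : ℝ) : ℝ :=
  open Classical in
  ∑ x : Fin n → S × A × S,
    (∏ i, d ((x i).1, (x i).2.1) * M.P (x i).1 (x i).2.1 (x i).2.2)
      * (est x : Measure (S × A → ℝ)).real {q | ‖q - M.qStar‖ ≤ ε}

/-! Upper bound. `qStar` is the fixed point of the Bellman operator, and the empirical operator is a
γ-contraction for every data set. Comparing iterates with `qStar` therefore needs the sampling noise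
at this one fixed function only: if the empirical operator moves `qStar` by at most η from time K
on, the error contracts by 1 - α(1-γ) per step down to η/(1-γ) (`norm_mbqIter_add_sub_qStar_le`). At
`qStar` the noise is an average of independent residuals, centred by the Bellman equation and
bounded by 2/(1-γ). Random visit counts need no conditioning: the residual minus η, set to zero off
the pair, is summed over all samples, and one Chernoff bound shows that the sum is negative except
with probability (1-ρ)^k, where ρ is of order d_min η²(1-γ)² (`sum_mul_exp_visitExcess_le`). A union
over pairs, signs and all k ≥ K, with η = (1-γ)ε/2, gives the power (1-γ)^4.

Lower bound. Two instances differ only in one self-loop probability, γ against γ + Δ with Δ of order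
(1-γ)²ε. Their optimal values differ by more than 2ε, so a correct estimator separates them, and the
Bhattacharyya coefficient of n samples is at most 2√δ. One sample loses at most Δ²/(1-γ), divided by
the number of pairs, which gives the power (1-γ)^3. -/

namespace FiniteMDP

/-! ### Bellman equations and the optimal Q-function -/

section Bellman

variable {S A : Type*} [Fintype S]

theorem abs_sum_P_mul_le (M : FiniteMDP S A) (s : S) (a : A) {f : S → ℝ} {c : ℝ}
    (hf : ∀ s', |f s'| ≤ c) : |∑ s', M.P s a s' * f s'| ≤ c := by
  calc |∑ s', M.P s a s' * f s'| ≤ ∑ s', |M.P s a s' * f s'| := Finset.abs_sum_le_sum_abs _ _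
    _ ≤ ∑ s', M.P s a s' * c := by
        refine Finset.sum_le_sum fun s' _ => ?_
        rw [abs_mul, abs_of_nonneg (M.P_nonneg s a s')]
        exact mul_le_mul_of_nonneg_left (hf s') (M.P_nonneg s a s')
    _ = c := by rw [← Finset.sum_mul, M.P_sum, one_mul]

theorem sum_P_mul_le (M : FiniteMDP S A) (s : S) (a : A) {f : S → ℝ} {c : ℝ}
    (hf : ∀ s', f s' ≤ c) : ∑ s', M.P s a s' * f s' ≤ c := by
  calc ∑ s', M.P s a s' * f s' ≤ ∑ s', M.P s a s' * c :=
        Finset.sum_le_sum fun s' _ => mul_le_mul_of_nonneg_left (hf s') (M.P_nonneg s a s')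
    _ = c := by rw [← Finset.sum_mul, M.P_sum, one_mul]

theorem abs_expReward_le (M : FiniteMDP S A) (π : S → A) (t : ℕ) (s : S) (a : A) :
    |M.expReward π t s a| ≤ 1 := by
  induction t generalizing s a with
  | zero => exact M.abs_sum_P_mul_le s a fun s' => M.r_bound s a s'
  | succ t ih => exact M.abs_sum_P_mul_le s a fun s' => ih s' (π s')

theorem summable_expReward (M : FiniteMDP S A) (π : S → A) (s : S) (a : A) :
    Summable fun t : ℕ => M.γ ^ t * M.expReward π t s a := by
  refine Summable.of_norm_bounded (summable_geometric_of_lt_one M.γ_nonneg M.γ_lt_one) fun t => ?_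
  rw [Real.norm_eq_abs, abs_mul, abs_of_nonneg (pow_nonneg M.γ_nonneg t)]
  exact mul_le_of_le_one_right (pow_nonneg M.γ_nonneg t) (M.abs_expReward_le π t s a)

theorem qPolicy_eq (M : FiniteMDP S A) (π : S → A) (s : S) (a : A) :
    M.qPolicy π (s, a) = ∑ s', M.P s a s' * (M.r s a s' + M.γ * M.qPolicy π (s', π s')) := by
  unfold qPolicy
  rw [(M.summable_expReward π s a).tsum_eq_zero_add]
  simp only [pow_zero, one_mul, expReward, mul_add, Finset.sum_add_distrib]
  congr 1
  have h : ∀ t : ℕ, M.γ ^ (t + 1) * ∑ s', M.P s a s' * M.expReward π t s' (π s')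
      = ∑ s', M.P s a s' * M.γ * (M.γ ^ t * M.expReward π t s' (π s')) := by
    intro t
    rw [Finset.mul_sum]
    exact Finset.sum_congr rfl fun s' _ => by ring
  simp only [h]
  rw [Summable.tsum_finsetSum fun s' _ => (M.summable_expReward π s' (π s')).mul_left _]
  exact Finset.sum_congr rfl fun s' _ => by rw [tsum_mul_left, mul_assoc]

variable [Fintype A]

/-- Comparison principle: a subsolution of the homogeneous evaluation equation is nonpositive. -/
theorem nonpos_of_le_discounted (M : FiniteMDP S A) (π : S → A) (f : S × A → ℝ)
    (hf : ∀ s a, f (s, a) ≤ M.γ * ∑ s', M.P s a s' * f (s', π s')) (y : S × A) : f y ≤ 0 := by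
  have : Nonempty (S × A) := ⟨y⟩
  -- At a maximum z, averaging gives f z ≤ γ f z, and γ < 1 forces f z ≤ 0.
  obtain ⟨z, hz⟩ := Finite.exists_max f
  have h1 : f z ≤ M.γ * f z := (hf z.1 z.2).trans
    (mul_le_mul_of_nonneg_left (M.sum_P_mul_le _ _ fun s' => hz _) M.γ_nonneg)
  nlinarith [hz y, M.γ_lt_one]

/-- The Bellman optimality operator. -/
noncomputable def bellman (M : FiniteMDP S A) (Q : S × A → ℝ) (y : S × A) : ℝ :=
  ∑ s', M.P y.1 y.2 s' * (M.r y.1 y.2 s' + M.γ * ⨆ u : A, Q (s', u))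

theorem abs_iSup_sub_iSup_le {ι : Type*} [Finite ι] [Nonempty ι] {f g : ι → ℝ} {c : ℝ}
    (h : ∀ i, |f i - g i| ≤ c) : |(⨆ i, f i) - ⨆ i, g i| ≤ c := by
  rw [abs_le]
  constructor
  · have : (⨆ i, g i) ≤ (⨆ i, f i) + c := ciSup_le fun i => by
      have := abs_le.1 (h i)
      have := le_ciSup (Set.finite_range f).bddAbove i
      linarith
    linarith
  · have : (⨆ i, f i) ≤ (⨆ i, g i) + c := ciSup_le fun i => by
      have := abs_le.1 (h i)
      have := le_ciSup (Set.finite_range g).bddAbove i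
      linarith
    linarith

theorem bellman_sub_le [Nonempty A] (M : FiniteMDP S A) (Q Q' : S × A → ℝ) :
    ‖M.bellman Q - M.bellman Q'‖ ≤ M.γ * ‖Q - Q'‖ := by
  rw [pi_norm_le_iff_of_nonneg (mul_nonneg M.γ_nonneg (norm_nonneg _))]
  rintro ⟨s, a⟩
  rw [Pi.sub_apply, bellman, bellman, ← Finset.sum_sub_distrib, Real.norm_eq_abs]
  simp only [← mul_sub]
  refine M.abs_sum_P_mul_le s a fun s' => ?_
  rw [add_sub_add_left_eq_sub, ← mul_sub, abs_mul, abs_of_nonneg M.γ_nonneg]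
  exact mul_le_mul_of_nonneg_left
    (abs_iSup_sub_iSup_le fun u => norm_le_pi_norm (Q - Q') (s', u)) M.γ_nonneg

/-- The comparison principle is applied twice: W dominates every policy value because the supremum
over actions dominates the action of π, and for a policy greedy with respect to W the inequality
reverses. Besides uniqueness, this allows `qStar` to be computed by guessing a solution. -/
theorem qStar_eq_of_bellman [Nonempty A] (M : FiniteMDP S A) (W : S × A → ℝ)
    (hW : M.bellman W = W) : M.qStar = W := by
  classical
  have hWy : ∀ s a, W (s, a)
      = ∑ s', M.P s a s' * (M.r s a s' + M.γ * ⨆ u : A, W (s', u)) :=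
    fun s a => (congrFun hW (s, a)).symm
  have hle : ∀ π : S → A, ∀ y, M.qPolicy π y ≤ W y := by
    intro π y
    have := M.nonpos_of_le_discounted π (fun y => M.qPolicy π y - W y) (fun s a => by
      rw [M.qPolicy_eq π s a, hWy s a, ← Finset.sum_sub_distrib, Finset.mul_sum]
      refine Finset.sum_le_sum fun s' _ => ?_
      have h1 : W (s', π s') ≤ ⨆ u : A, W (s', u) :=
        le_ciSup (f := fun u => W (s', u)) (Set.finite_range _).bddAbove (π s')
      have h2 := mul_le_mul_of_nonneg_left h1 (mul_nonneg (M.P_nonneg s a s') M.γ_nonneg)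
      linarith) y
    linarith
  have hg : ∀ s, ∃ a, W (s, a) = ⨆ u : A, W (s, u) := fun s =>
    exists_eq_ciSup_of_finite
  choose π hπ using hg
  have hge : ∀ y, W y ≤ M.qPolicy π y := by
    intro y
    have := M.nonpos_of_le_discounted π (fun y => W y - M.qPolicy π y) (fun s a => by
      rw [M.qPolicy_eq π s a, hWy s a, ← Finset.sum_sub_distrib, Finset.mul_sum]
      refine Finset.sum_le_sum fun s' _ => ?_
      rw [← hπ]
      linarith) y
    linarith
  funext y
  refine le_antisymm (ciSup_le fun π => hle π y) ?_
  exact (hge y).trans (le_ciSup (f := fun π => M.qPolicy π y) (Set.finite_range _).bddAbove π)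

/-- The optimal Q-function solves the Bellman optimality equation. -/
theorem bellman_qStar [Nonempty A] (M : FiniteMDP S A) : M.bellman M.qStar = M.qStar := by
  -- Banach's theorem supplies some fixed point; the previous characterization identifies it with
  -- `qStar`.
  have hc : ContractingWith ⟨M.γ, M.γ_nonneg⟩ M.bellman := by
    refine ⟨M.γ_lt_one, LipschitzWith.of_dist_le_mul fun Q Q' => ?_⟩
    rw [dist_eq_norm, dist_eq_norm]
    exact M.bellman_sub_le Q Q'
  have hfix := hc.fixedPoint_isFixedPt
  rw [M.qStar_eq_of_bellman _ hfix]
  exact hfix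

theorem norm_qStar_le [Nonempty A] (M : FiniteMDP S A) : ‖M.qStar‖ ≤ 1 / (1 - M.γ) := by
  have h1 : 0 < 1 - M.γ := sub_pos.2 M.γ_lt_one
  rw [pi_norm_le_iff_of_nonneg (by positivity)]
  intro y
  have hq : ∀ π : S → A, |M.qPolicy π y| ≤ 1 / (1 - M.γ) := by
    intro π
    rw [one_div, ← Real.norm_eq_abs]
    refine tsum_of_norm_bounded (hasSum_geometric_of_lt_one M.γ_nonneg M.γ_lt_one) fun t => ?_
    rw [Real.norm_eq_abs, abs_mul, abs_of_nonneg (pow_nonneg M.γ_nonneg t)]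
    exact mul_le_of_le_one_right (pow_nonneg M.γ_nonneg t) (M.abs_expReward_le π t _ _)
  obtain ⟨π, hπ⟩ := exists_eq_ciSup_of_finite (f := fun π : S → A => M.qPolicy π y)
  have : M.qStar y = M.qPolicy π y := hπ.symm
  rw [this]
  exact hq π

end Bellman

end FiniteMDP

/-! ### Lower bound by two-point testing -/

section LowerBound

/-- Two-point testing bound: if two tests with disjoint acceptance both succeed with probability at
least `1 - δ`, then the Bhattacharyya coefficient of the two laws is at most `2 √δ`. -/
theorem sum_sqrt_mul_le_of_tests {X : Type*} [Fintype X] {p q g h : X → ℝ} {δ : ℝ}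
    (hp : ∀ x, 0 ≤ p x) (hq : ∀ x, 0 ≤ q x) (hp1 : ∑ x, p x = 1) (hq1 : ∑ x, q x = 1)
    (hg : ∀ x, 0 ≤ g x) (hh : ∀ x, 0 ≤ h x) (hgh : ∀ x, g x + h x ≤ 1)
    (hpg : 1 - δ ≤ ∑ x, p x * g x) (hqh : 1 - δ ≤ ∑ x, q x * h x) :
    ∑ x, √(p x * q x) ≤ 2 * √δ := by
  have hg1 : ∀ x, 0 ≤ 1 - g x := fun x => by linarith [hgh x, hh x]
  have e1 : ∑ x, p x * (1 - g x) ≤ δ := by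
    simp only [mul_sub, mul_one, Finset.sum_sub_distrib, hp1]
    linarith
  have e2 : ∑ x, q x * g x ≤ δ := by
    have : ∑ x, q x * g x ≤ ∑ x, q x * (1 - h x) :=
      Finset.sum_le_sum fun x _ => mul_le_mul_of_nonneg_left (by linarith [hgh x]) (hq x)
    simp only [mul_sub, mul_one, Finset.sum_sub_distrib, hq1] at this
    linarith
  have e3 : ∑ x, p x * g x ≤ 1 := by
    rw [← hp1]
    exact Finset.sum_le_sum fun x _ => mul_le_of_le_one_right (hp x) (by linarith [hg1 x])
  have e4 : ∑ x, q x * (1 - g x) ≤ 1 := by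
    rw [← hq1]
    exact Finset.sum_le_sum fun x _ => mul_le_of_le_one_right (hq x) (by linarith [hg x])
  -- Cauchy–Schwarz on each half: under g, the q-mass is an error of size δ; under 1 - g, the p-mass
  -- is.
  have split : ∀ x, √(p x * q x)
      = √(p x * g x) * √(q x * g x) + √(p x * (1 - g x)) * √(q x * (1 - g x)) := by
    intro x
    rw [← Real.sqrt_mul (mul_nonneg (hp x) (hg x)), ← Real.sqrt_mul (mul_nonneg (hp x) (hg1 x)),
      show p x * g x * (q x * g x) = g x ^ 2 * (p x * q x) by ring,
      show p x * (1 - g x) * (q x * (1 - g x)) = (1 - g x) ^ 2 * (p x * q x) by ring,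
      Real.sqrt_mul (sq_nonneg _), Real.sqrt_mul (sq_nonneg _), Real.sqrt_sq (hg x),
      Real.sqrt_sq (hg1 x)]
    ring
  simp only [split, Finset.sum_add_distrib]
  have c1 := Real.sum_sqrt_mul_sqrt_le Finset.univ (fun x => mul_nonneg (hp x) (hg x))
    (fun x => mul_nonneg (hq x) (hg x))
  have c2 := Real.sum_sqrt_mul_sqrt_le Finset.univ (fun x => mul_nonneg (hp x) (hg1 x))
    (fun x => mul_nonneg (hq x) (hg1 x))
  have d1 : √(∑ x, p x * g x) * √(∑ x, q x * g x) ≤ 1 * √δ :=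
    mul_le_mul (Real.sqrt_le_one.2 e3) (Real.sqrt_le_sqrt e2) (Real.sqrt_nonneg _) zero_le_one
  have d2 : √(∑ x, p x * (1 - g x)) * √(∑ x, q x * (1 - g x)) ≤ √δ * 1 :=
    mul_le_mul (Real.sqrt_le_sqrt e1) (Real.sqrt_le_one.2 e4) (Real.sqrt_nonneg _)
      (Real.sqrt_nonneg _)
  linarith

/-- The Bhattacharyya coefficient is multiplicative over i.i.d. samples. -/
theorem sum_sqrt_prod_mul_prod {Y : Type*} [Fintype Y] {p q : Y → ℝ} (n : ℕ)
    (hp : ∀ y, 0 ≤ p y) (hq : ∀ y, 0 ≤ q y) :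
    ∑ x : Fin n → Y, √((∏ i, p (x i)) * ∏ i, q (x i)) = (∑ y, √(p y * q y)) ^ n := by
  classical
  rw [Fintype.sum_pow]
  refine Finset.sum_congr rfl fun x _ => ?_
  rw [← Finset.prod_mul_distrib, Real.sqrt_eq_iff_mul_self_eq
    (Finset.prod_nonneg fun i _ => mul_nonneg (hp _) (hq _))
    (Finset.prod_nonneg fun i _ => Real.sqrt_nonneg _), ← Finset.prod_mul_distrib]
  exact Finset.prod_congr rfl fun i _ => (Real.mul_self_sqrt (mul_nonneg (hp _) (hq _))).symm

/-- If the optimal Q-functions of two decision processes are more than `2 ε` apart, an estimator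
that is `(ε, δ)`-correct on both forces their sample laws to have small Bhattacharyya
coefficient. -/
theorem bhattacharyya_pow_le_of_successProb {S A : Type*} [Fintype S] [Fintype A]
    (M M' : FiniteMDP S A) (d : S × A → ℝ) (hd : ∀ y, 0 ≤ d y) (hd1 : ∑ y, d y = 1) (n : ℕ)
    (est : (Fin n → S × A × S) → ProbabilityMeasure (S × A → ℝ)) {ε δ : ℝ}
    (hsep : 2 * ε < ‖M.qStar - M'.qStar‖) (h : 1 - δ ≤ successProb M d n est ε)
    (h' : 1 - δ ≤ successProb M' d n est ε) :
    (∑ y : S × A × S, √((d (y.1, y.2.1) * M.P y.1 y.2.1 y.2.2)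
      * (d (y.1, y.2.1) * M'.P y.1 y.2.1 y.2.2))) ^ n ≤ 2 * √δ := by
  classical
  have hnn : ∀ (N : FiniteMDP S A) (y : S × A × S),
      0 ≤ d (y.1, y.2.1) * N.P y.1 y.2.1 y.2.2 :=
    fun N y => mul_nonneg (hd _) (N.P_nonneg _ _ _)
  have hsum : ∀ N : FiniteMDP S A,
      ∑ y : S × A × S, d (y.1, y.2.1) * N.P y.1 y.2.1 y.2.2 = 1 := by
    intro N
    rw [← hd1, Fintype.sum_prod_type, Fintype.sum_prod_type]
    refine Finset.sum_congr rfl fun s _ => ?_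
    rw [Fintype.sum_prod_type]
    refine Finset.sum_congr rfl fun a _ => ?_
    change ∑ s', d (s, a) * N.P s a s' = d (s, a)
    rw [← Finset.mul_sum, N.P_sum, mul_one]
  have hsum' : ∀ N : FiniteMDP S A, ∑ x : Fin n → S × A × S,
      ∏ i, d ((x i).1, (x i).2.1) * N.P (x i).1 (x i).2.1 (x i).2.2 = 1 := by
    intro N
    rw [← Fintype.sum_pow fun y : S × A × S => d (y.1, y.2.1) * N.P y.1 y.2.1 y.2.2, hsum, one_pow]
  rw [← sum_sqrt_prod_mul_prod n (hnn M) (hnn M')]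
  refine sum_sqrt_mul_le_of_tests
    (g := fun x => (est x : Measure (S × A → ℝ)).real {q | ‖q - M.qStar‖ ≤ ε})
    (h := fun x => (est x : Measure (S × A → ℝ)).real {q | ‖q - M'.qStar‖ ≤ ε})
    (fun x => Finset.prod_nonneg fun i _ => hnn M _)
    (fun x => Finset.prod_nonneg fun i _ => hnn M' _) (hsum' M) (hsum' M')
    (fun x => measureReal_nonneg) (fun x => measureReal_nonneg) (fun x => ?_) h h'
  -- No output is ε-close to both optimal functions, so the two success events act as disjoint
  -- tests.
  have hdisj : Disjoint {q : S × A → ℝ | ‖q - M.qStar‖ ≤ ε} {q | ‖q - M'.qStar‖ ≤ ε} := by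
    rw [Set.disjoint_left]
    intro q hq hq'
    simp only [Set.mem_ofPred_eq] at hq hq'
    have := norm_sub_le (q - M'.qStar) (q - M.qStar)
    rw [sub_sub_sub_cancel_left] at this
    linarith
  have hmeas : MeasurableSet {q : S × A → ℝ | ‖q - M'.qStar‖ ≤ ε} :=
    (isClosed_le (by fun_prop) continuous_const).measurableSet
  rw [← measureReal_union hdisj hmeas]
  exact measureReal_le_one

open Classical in
/-- The hard instance: only the pair `(s₀, a₀)` is rewarded; it returns to `s₀` with probability
`p`, and everything else moves to `s₁`. -/
noncomputable def hardMDP {S A : Type*} [Fintype S] (s₀ s₁ : S) (a₀ : A) (hs : s₀ ≠ s₁) (γ p : ℝ)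
    (hγ : 0 ≤ γ) (hγ1 : γ < 1) (hp : 0 ≤ p) (hp1 : p ≤ 1) : FiniteMDP S A where
  P s a s' := if s = s₀ ∧ a = a₀ then (if s' = s₀ then p else if s' = s₁ then 1 - p else 0)
    else if s' = s₁ then 1 else 0
  P_nonneg s a s' := by
    split_ifs <;> linarith
  P_sum s a := by
    split_ifs
    · have : ∀ s', (if s' = s₀ then p else if s' = s₁ then 1 - p else 0)
          = (if s' = s₀ then p else 0) + if s' = s₁ then 1 - p else 0 := by
        intro s'
        by_cases h : s' = s₀
        · simp [h, hs]
        · simp [h]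
      simp [this, Finset.sum_add_distrib]
    · simp
  r s a _ := if s = s₀ ∧ a = a₀ then 1 else 0
  r_bound s a s' := by split_ifs <;> simp
  γ := γ
  γ_nonneg := hγ
  γ_lt_one := hγ1

open Classical in
-- The function supported on (s₀, a₀) with value v = 1 + γpv solves the Bellman equation: every
-- other pair earns nothing and leads to s₁, where this function vanishes.
theorem qStar_hardMDP {S A : Type*} [Fintype S] [Fintype A] (s₀ s₁ : S) (a₀ : A) (hs : s₀ ≠ s₁)
    (γ p : ℝ) (hγ : 0 ≤ γ) (hγ1 : γ < 1) (hp : 0 ≤ p) (hp1 : p ≤ 1) :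
    (hardMDP s₀ s₁ a₀ hs γ p hγ hγ1 hp hp1).qStar (s₀, a₀) = 1 / (1 - γ * p) := by
  have : Nonempty A := ⟨a₀⟩
  have hpos : 0 < 1 - γ * p := by nlinarith
  set v := 1 / (1 - γ * p) with hv
  have hv0 : 0 ≤ v := by positivity
  have hve : 1 + γ * p * v = v := by rw [hv]; field_simp; ring
  let W : S × A → ℝ := fun y => if y.1 = s₀ ∧ y.2 = a₀ then v else 0
  have hsup0 : ⨆ u : A, W (s₀, u) = v := by
    refine le_antisymm (ciSup_le fun u => ?_) ?_
    · simp only [W]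
      split_ifs <;> linarith
    · have := le_ciSup (f := fun u => W (s₀, u)) (Set.finite_range _).bddAbove a₀
      simpa [W] using this
  have hsup : ∀ s, s ≠ s₀ → ⨆ u : A, W (s, u) = 0 := by
    intro s h
    simp [W, h]
  rw [FiniteMDP.qStar_eq_of_bellman _ W]
  · simp [W]
  · funext y
    obtain ⟨s, a⟩ := y
    have hVe : ∀ s', ⨆ u : A, W (s', u) = if s' = s₀ then v else 0 := by
      intro s'
      split_ifs with h
      · rw [h, hsup0]
      · exact hsup s' h
    simp only [FiniteMDP.bellman, hVe, hardMDP, W]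
    by_cases h : s = s₀ ∧ a = a₀
    · simp only [h, and_self, if_true]
      have : ∀ s', (if s' = s₀ then p else if s' = s₁ then 1 - p else 0)
            * (1 + γ * if s' = s₀ then v else 0)
          = (if s' = s₀ then p * (1 + γ * v) else 0) + if s' = s₁ then 1 - p else 0 := by
        intro s'
        by_cases h : s' = s₀
        · simp [h, hs]
        · simp [h]
      simp only [this, Finset.sum_add_distrib, Finset.sum_ite_eq', Finset.mem_univ, if_true]
      linarith
    · simp only [h, if_false, zero_add, ite_mul, one_mul, zero_mul, Finset.sum_ite_eq',
        Finset.mem_univ, if_true, hs.symm, mul_zero]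

/-- The squared Hellinger distance of two Bernoulli laws is controlled by the chi-square
distance. -/
theorem one_sub_le_sqrt_add_sqrt {p Δ : ℝ} (hp : 0 < p) (hp1 : p < 1) (hΔ : 0 ≤ Δ)
    (hpΔ : p + Δ ≤ 1) :
    1 - Δ ^ 2 / 2 * (1 / p + 1 / (1 - p))
      ≤ √(p * (p + Δ)) + √((1 - p) * (1 - (p + Δ))) := by
  -- √(xy) = (x + y)/2 - (√x - √y)²/2, and (√x - √y)² ≤ (x - y)²/x because (√x + √y)² ≥ x. Over the
  -- two outcomes the linear terms add up to 1.
  have key : ∀ x y : ℝ, 0 < x → 0 ≤ y → (x + y) / 2 - (x - y) ^ 2 / 2 * (1 / x) ≤ √(x * y) := by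
    intro x y hx hy
    obtain ⟨a, ha, rfl⟩ : ∃ a, 0 < a ∧ x = a ^ 2 :=
      ⟨√x, Real.sqrt_pos.2 hx, (Real.sq_sqrt hx.le).symm⟩
    obtain ⟨b, hb, rfl⟩ : ∃ b, 0 ≤ b ∧ y = b ^ 2 :=
      ⟨√y, Real.sqrt_nonneg y, (Real.sq_sqrt hy).symm⟩
    rw [← mul_pow, Real.sqrt_sq (mul_nonneg ha.le hb)]
    have h1 : (a - b) ^ 2 ≤ (a ^ 2 - b ^ 2) ^ 2 * (1 / a ^ 2) := by
      rw [mul_one_div, le_div_iff₀ (by positivity), show (a ^ 2 - b ^ 2) ^ 2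
        = (a - b) ^ 2 * (a + b) ^ 2 by ring]
      exact mul_le_mul_of_nonneg_left (pow_le_pow_left₀ ha.le (by linarith) 2) (sq_nonneg _)
    linarith
  have h1 := key p (p + Δ) hp (by linarith)
  have h2 := key (1 - p) (1 - (p + Δ)) (by linarith) (by linarith)
  have h3 : p - (p + Δ) = -Δ := by ring
  have h4 : 1 - p - (1 - (p + Δ)) = Δ := by ring
  rw [h3, neg_sq] at h1
  rw [h4] at h2
  linarith

/-- Two hard instances with uniform sampling are statistically close. -/
theorem bhattacharyya_hardMDP_ge {S A : Type*} [Fintype S] [Fintype A] (s₀ s₁ : S) (a₀ : A)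
    (hs : s₀ ≠ s₁) (γ p p' h : ℝ) (hγ : 0 ≤ γ) (hγ1 : γ < 1) (hp : 0 ≤ p) (hp1 : p ≤ 1)
    (hp' : 0 ≤ p') (hp1' : p' ≤ 1) (hh : 1 - h ≤ √(p * p') + √((1 - p) * (1 - p'))) :
    1 - h / (Fintype.card S * Fintype.card A : ℝ) ≤ ∑ y : S × A × S,
      √((unifDist S A (y.1, y.2.1) * (hardMDP s₀ s₁ a₀ hs γ p hγ hγ1 hp hp1).P y.1 y.2.1 y.2.2)
      * (unifDist S A (y.1, y.2.1)
        * (hardMDP s₀ s₁ a₀ hs γ p' hγ hγ1 hp' hp1').P y.1 y.2.1 y.2.2)) := by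
  classical
  have hS : (0 : ℝ) < Fintype.card S := Nat.cast_pos.2 (Fintype.card_pos_iff.2 ⟨s₀⟩)
  have hA : (0 : ℝ) < Fintype.card A := Nat.cast_pos.2 (Fintype.card_pos_iff.2 ⟨a₀⟩)
  set u : ℝ := 1 / (Fintype.card S * Fintype.card A : ℝ) with hu
  have hu0 : 0 ≤ u := by positivity
  -- Only the row of (s₀, a₀) distinguishes the instances, and it is sampled with probability u;
  -- this dilutes the loss h by the number of pairs.
  have hrow : ∀ s a, u * (1 - if s = s₀ ∧ a = a₀ then h else 0) ≤ ∑ s',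
      √((u * (hardMDP s₀ s₁ a₀ hs γ p hγ hγ1 hp hp1).P s a s')
        * (u * (hardMDP s₀ s₁ a₀ hs γ p' hγ hγ1 hp' hp1').P s a s')) := by
    intro s a
    have : ∀ x y : ℝ, √(u * x * (u * y)) = u * √(x * y) := by
      intro x y
      rw [show u * x * (u * y) = u ^ 2 * (x * y) by ring, Real.sqrt_mul (sq_nonneg u),
        Real.sqrt_sq hu0]
    simp only [this, ← Finset.mul_sum]
    refine mul_le_mul_of_nonneg_left ?_ hu0
    by_cases hsa : s = s₀ ∧ a = a₀
    · simp only [hardMDP, hsa, and_self, if_true]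
      refine hh.trans ?_
      have hpair := Finset.sum_le_univ_sum_of_nonneg (s := {s₀, s₁})
        (f := fun s' => √((if s' = s₀ then p else if s' = s₁ then 1 - p else 0)
          * if s' = s₀ then p' else if s' = s₁ then 1 - p' else 0)) fun s' => Real.sqrt_nonneg _
      rw [Finset.sum_pair hs] at hpair
      simpa [hs.symm] using hpair
    · have hone := Finset.single_le_sum (f := fun s' : S => √((if s' = s₁ then (1 : ℝ) else 0)
        * if s' = s₁ then 1 else 0)) (fun s' _ => Real.sqrt_nonneg _) (Finset.mem_univ s₁)
      simpa only [hardMDP, hsa, if_false, sub_zero, if_true, mul_one, Real.sqrt_one] using hone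
  have htot : ∑ s, ∑ a, u * (1 - if s = s₀ ∧ a = a₀ then h else 0)
      = 1 - h / (Fintype.card S * Fintype.card A : ℝ) := by
    have h1 : ∀ (s : S) (a : A), (if s = s₀ ∧ a = a₀ then h else 0)
        = if a = a₀ then (if s = s₀ then h else 0) else 0 := by
      intro s a
      by_cases h1 : s = s₀ <;> by_cases h2 : a = a₀ <;> simp [h1, h2]
    simp only [← Finset.mul_sum, Finset.sum_sub_distrib, h1, Finset.sum_ite_eq', Finset.mem_univ,
      if_true, Finset.sum_const, Finset.card_univ, nsmul_eq_mul, mul_one]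
    rw [hu]
    field_simp
  rw [← htot, Fintype.sum_prod_type]
  refine Finset.sum_le_sum fun s _ => ?_
  rw [Fintype.sum_prod_type]
  exact Finset.sum_le_sum fun a _ => hrow s a

/-- From 1 - x ≥ exp(-2x) one gets 2xn ≥ log(1/δ)/2 - log 2, and δ ≤ 1/8 bounds log 2 by log(1/δ)/3.
-/
theorem sample_size_of_pow_le {x δ : ℝ} {n : ℕ} (hx0 : 0 ≤ x) (hx : x ≤ 1 / 2) (hδ : 0 < δ)
    (hδ8 : δ ≤ 1 / 8) (h : (1 - x) ^ n ≤ 2 * √δ) : Real.log (1 / δ) / 12 ≤ x * n := by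
  have h1 : Real.exp (-(2 * x)) ≤ 1 - x := by
    have h2 : 1 + 2 * x ≤ Real.exp (2 * x) := by linarith [Real.add_one_le_exp (2 * x)]
    rw [Real.exp_neg, inv_le_comm₀ (Real.exp_pos _) (by linarith)]
    refine le_trans ?_ h2
    rw [inv_le_iff_one_le_mul₀ (by linarith)]
    nlinarith
  have h2 : Real.exp (n * -(2 * x)) ≤ 2 * √δ := by
    rw [Real.exp_nat_mul]
    exact (pow_le_pow_left₀ (Real.exp_pos _).le h1 n).trans h
  have hδs : 0 < √δ := Real.sqrt_pos.2 hδ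
  rw [← Real.le_log_iff_exp_le (by positivity), Real.log_mul (by norm_num) hδs.ne',
    Real.log_sqrt hδ.le] at h2
  have h3 : Real.log δ ≤ -(3 * Real.log 2) := by
    have := Real.log_le_log hδ hδ8
    rwa [show (1 : ℝ) / 8 = (2 ^ 3)⁻¹ by norm_num, Real.log_inv, Real.log_pow,
      Nat.cast_ofNat] at this
  rw [one_div, Real.log_inv]
  linarith

theorem exists_lower_bound : ∃ c : ℝ, 0 < c ∧
    ∀ (S A : Type*) [Fintype S] [Fintype A] [Nonempty A] (γ ε δ : ℝ),
      2 ≤ Fintype.card S → 1 / 2 ≤ γ → γ < 1 → 0 < ε → ε ≤ c / (1 - γ) →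
      0 < δ → δ ≤ 1 / 8 →
      ∃ r : S → A → S → ℝ, (∀ s a s', |r s a s'| ≤ 1) ∧
        ∀ (n : ℕ) (est : (Fin n → S × A × S) → ProbabilityMeasure (S × A → ℝ)),
          (∀ M : FiniteMDP S A, M.r = r → M.γ = γ →
            1 - δ ≤ successProb M (unifDist S A) n est ε) →
          c * ((Fintype.card S * Fintype.card A : ℝ) / ((1 - γ) ^ 3 * ε ^ 2))
              * Real.log (1 / δ) ≤ (n : ℝ) := by
  -- 6912 = 12 · 576: the 12 comes from `sample_size_of_pow_le`, and 576 = 24² from the square of Δ.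
  refine ⟨1 / 6912, by norm_num, ?_⟩
  intro S A _ _ _ γ ε δ hcard hγ hγ1 hε hεc hδ hδ8
  obtain ⟨s₀, s₁, hs⟩ := Fintype.exists_pair_of_one_lt_card (α := S) (by omega)
  obtain ⟨a₀⟩ := ‹Nonempty A›
  obtain ⟨β, rfl⟩ : ∃ β, γ = 1 - β := ⟨1 - γ, by ring⟩
  have hβ : 0 < β := by linarith
  rw [sub_sub_cancel] at hεc ⊢
  rw [le_div_iff₀ hβ] at hεc
  -- Both denominators 1 - γp are at most 2β and γ ≥ 1/2, so the two values differ by at least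
  -- (Δ/2)/(4β²) = 3ε.
  set Δ := 24 * β ^ 2 * ε with hΔ
  have hΔ0 : 0 < Δ := by positivity
  have hΔβ : Δ ≤ β / 2 := by
    rw [hΔ, show 24 * β ^ 2 * ε = 24 * (ε * β) * β by ring]
    nlinarith
  have hγ0 : 0 ≤ 1 - β := by linarith
  have hp1 : 1 - β ≤ 1 := by linarith
  have hp' : 0 ≤ 1 - β + Δ := by linarith
  have hp1' : 1 - β + Δ ≤ 1 := by linarith
  -- Return probability γ gives a Bernoulli law of variance at most β. The chi-square cost is then
  -- of order Δ²/β, which is of order β³ε².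
  let M := hardMDP s₀ s₁ a₀ hs (1 - β) (1 - β) hγ0 hγ1 hγ0 hp1
  let M' := hardMDP s₀ s₁ a₀ hs (1 - β) (1 - β + Δ) hγ0 hγ1 hp' hp1'
  refine ⟨M.r, M.r_bound, fun n est hest => ?_⟩
  have hS : (2 : ℝ) ≤ Fintype.card S := by exact_mod_cast hcard
  have hA : (1 : ℝ) ≤ Fintype.card A := by exact_mod_cast Fintype.card_pos_iff.2 ⟨a₀⟩
  set N := (Fintype.card S * Fintype.card A : ℝ) with hN
  have hN1 : 2 ≤ N := by nlinarith
  have hsep : 2 * ε < ‖M.qStar - M'.qStar‖ := by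
    refine lt_of_lt_of_le ?_ (norm_le_pi_norm _ (s₀, a₀))
    rw [Pi.sub_apply, qStar_hardMDP, qStar_hardMDP, norm_sub_rev, Real.norm_eq_abs]
    refine lt_of_lt_of_le ?_ (le_abs_self _)
    have e1 : 0 < 1 - (1 - β) * (1 - β) := by nlinarith
    have e2 : 0 < 1 - (1 - β) * (1 - β + Δ) := by nlinarith
    rw [div_sub_div _ _ e2.ne' e1.ne', lt_div_iff₀ (mul_pos e2 e1)]
    have e3 : 1 - (1 - β) * (1 - β) ≤ 2 * β := by nlinarith
    have e4 : 1 - (1 - β) * (1 - β + Δ) ≤ 2 * β := by nlinarith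
    have e5 := mul_le_mul e4 e3 e1.le (by positivity)
    have e6 : 2 * ε * ((1 - (1 - β) * (1 - β + Δ)) * (1 - (1 - β) * (1 - β)))
        ≤ 2 * ε * (2 * β * (2 * β)) := mul_le_mul_of_nonneg_left e5 (by positivity)
    have e7 : 2 * ε * (2 * β * (2 * β)) = Δ / 3 := by rw [hΔ]; ring
    nlinarith
  have hu0 : ∀ y, 0 ≤ unifDist S A y := fun y => by
    rw [unifDist]; positivity
  have hu1 : ∑ y, unifDist S A y = 1 := by
    simp only [unifDist, Finset.sum_const, Finset.card_univ, Fintype.card_prod, nsmul_eq_mul,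
      Nat.cast_mul]
    rw [mul_one_div, div_self (by positivity)]
  have hbc := bhattacharyya_pow_le_of_successProb M M' _ hu0 hu1 n est hsep (hest M rfl rfl)
    (hest M' rfl rfl)
  set h := Δ ^ 2 / 2 * (1 / (1 - β) + 1 / (1 - (1 - β))) with hh
  have hh0 : 0 ≤ h := by
    rw [hh, sub_sub_cancel]; positivity
  have hhle : h ≤ Δ ^ 2 / β := by
    have : 1 / (1 - β) ≤ 1 / β := one_div_le_one_div_of_le hβ (by linarith)
    rw [hh, sub_sub_cancel, div_eq_mul_one_div (Δ ^ 2) β]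
    nlinarith [sq_nonneg Δ]
  have hh2 : h ≤ 1 / 2 := by
    refine hhle.trans ?_
    rw [div_le_iff₀ hβ]
    nlinarith
  have hlow := bhattacharyya_hardMDP_ge s₀ s₁ a₀ hs (1 - β) (1 - β) (1 - β + Δ) h hγ0 hγ1 hγ0 hp1
    hp' hp1' (one_sub_le_sqrt_add_sqrt (by linarith) hγ1 hΔ0.le hp1')
  have hx : h / N ≤ 1 / 2 := (div_le_self hh0 (by linarith)).trans hh2
  have hfin := sample_size_of_pow_le (n := n) (by positivity) hx hδ hδ8
    ((pow_le_pow_left₀ (by linarith) hlow n).trans hbc)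
  have hxle : h / N ≤ 576 * (β ^ 3 * ε ^ 2) / N := by
    refine div_le_div_of_nonneg_right (hhle.trans (le_of_eq ?_)) (by linarith)
    rw [hΔ]
    field_simp
    ring
  have hn : (0 : ℝ) ≤ n := Nat.cast_nonneg n
  have h9 := hfin.trans (mul_le_mul_of_nonneg_right hxle hn)
  have h10 : 1 / 6912 * (N / (β ^ 3 * ε ^ 2)) * Real.log (1 / δ)
      = Real.log (1 / δ) / 12 * (N / (576 * (β ^ 3 * ε ^ 2))) := by
    field_simp
    ring
  rw [h10]
  calc _ ≤ 576 * (β ^ 3 * ε ^ 2) / N * n * (N / (576 * (β ^ 3 * ε ^ 2))) :=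
        mul_le_mul_of_nonneg_right h9 (by positivity)
    _ = n := by field_simp

end LowerBound

/-! ### Pathwise analysis of the iteration -/

section Iterates

variable {S A : Type*}

open Classical in
/-- The average of `g` over the successor states seen in the visits to `(s, a)`. -/
noncomputable def visitAvg (x : ℕ → S × A × S) (k : ℕ) (s : S) (a : A) (g : S → ℝ) : ℝ :=
  (∑ i ∈ (Finset.range k).filter (fun i => (x i).1 = s ∧ (x i).2.1 = a), g (x i).2.2)
    / (visitCount x k s a : ℝ)

theorem abs_visitAvg_le (x : ℕ → S × A × S) (k : ℕ) (s : S) (a : A) {g : S → ℝ} {c : ℝ}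
    (hc : 0 ≤ c) (hg : ∀ s', |g s'| ≤ c) : |visitAvg x k s a g| ≤ c := by
  classical
  rw [visitAvg, abs_div, Nat.abs_cast]
  -- This covers an unvisited pair too, whose average is 0/0 = 0; hence the requirement 0 ≤ c.
  refine div_le_of_le_mul₀ (Nat.cast_nonneg _) hc ((Finset.abs_sum_le_sum_abs _ _).trans ?_)
  refine (Finset.sum_le_sum fun i _ => hg _).trans ?_
  rw [Finset.sum_const, nsmul_eq_mul, mul_comm]
  unfold visitCount
  exact le_of_eq (by congr!)

theorem visitAvg_sub (x : ℕ → S × A × S) (k : ℕ) (s : S) (a : A) (g g' : S → ℝ) :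
    visitAvg x k s a g - visitAvg x k s a g' = visitAvg x k s a (g - g') := by
  simp only [visitAvg, Pi.sub_apply, Finset.sum_sub_distrib, sub_div]

/-- Grouping the visits by successor state turns the model-based update into a plain sample average.
-/
theorem empBackup_eq_visitAvg [Fintype S] (r : S → A → S → ℝ) (γ : ℝ) (x : ℕ → S × A × S) (k : ℕ)
    (s : S) (a : A) (V : S → ℝ) :
    empReward r x k s a + γ * ∑ s', empTrans x k s a s' * V s'
      = visitAvg x k s a fun s' => r s a s' + γ * V s' := by
  classical
  have h1 : empReward r x k s a = visitAvg x k s a (r s a) := by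
    unfold empReward visitAvg
    congr 1
    refine Finset.sum_congr rfl fun i hi => ?_
    obtain ⟨-, h1, h2⟩ := Finset.mem_filter.1 hi
    rw [h1, h2]
  have h2 : ∑ s', empTrans x k s a s' * V s' = visitAvg x k s a V := by
    unfold empTrans visitAvg transCount
    simp only [div_mul_eq_mul_div]
    rw [← Finset.sum_div]
    congr 1
    rw [← Finset.sum_fiberwise _ (fun i => (x i).2.2)]
    refine Finset.sum_congr rfl fun s' _ => ?_
    rw [Finset.sum_congr rfl (g := fun _ => V s')
      (fun i hi => by rw [(Finset.mem_filter.1 hi).2]), Finset.sum_const, nsmul_eq_mul,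
      Finset.filter_filter]
    congr 3
    ext i
    simp [Prod.ext_iff, and_assoc]
  rw [h1, h2]
  simp only [visitAvg, Finset.sum_add_distrib, ← Finset.mul_sum]
  ring

/-- The Bellman operator of the empirical model. -/
noncomputable def empBellman [Fintype S] (M : FiniteMDP S A) (x : ℕ → S × A × S) (k : ℕ)
    (Q : S × A → ℝ) (y : S × A) : ℝ :=
  visitAvg x k y.1 y.2 fun s' => M.r y.1 y.2 s' + M.γ * ⨆ u : A, Q (s', u)

theorem mbqIter_succ_of_le [Fintype S] (M : FiniteMDP S A) (α : ℝ) {m k : ℕ} (Q₀ : S × A → ℝ)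
    (x : ℕ → S × A × S) (h : m ≤ k) : mbqIter M α m Q₀ x (k + 1) =
      mbqIter M α m Q₀ x k
        + α • (empBellman M x (k + 1) (mbqIter M α m Q₀ x k) - mbqIter M α m Q₀ x k) := by
  funext y
  rw [mbqIter, if_neg h.not_gt, empBackup_eq_visitAvg]
  rfl

theorem mbqIter_succ_of_lt [Fintype S] (M : FiniteMDP S A) (α : ℝ) {m k : ℕ} (Q₀ : S × A → ℝ)
    (x : ℕ → S × A × S) (h : k < m) : mbqIter M α m Q₀ x (k + 1) = mbqIter M α m Q₀ x k := by
  rw [mbqIter, if_pos h]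

variable [Fintype S] [Fintype A] [Nonempty A]

/-- Visit averaging is substochastic, with zero rows at unvisited pairs, so the contraction holds
for every sample path. -/
theorem empBellman_sub_le (M : FiniteMDP S A) (x : ℕ → S × A × S) (k : ℕ) (Q Q' : S × A → ℝ) :
    ‖empBellman M x k Q - empBellman M x k Q'‖ ≤ M.γ * ‖Q - Q'‖ := by
  have h0 : 0 ≤ M.γ * ‖Q - Q'‖ := mul_nonneg M.γ_nonneg (norm_nonneg _)
  rw [pi_norm_le_iff_of_nonneg h0]
  rintro ⟨s, a⟩
  rw [Pi.sub_apply, empBellman, empBellman, visitAvg_sub]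
  refine abs_visitAvg_le x k s a h0 fun s' => ?_
  rw [Pi.sub_apply, add_sub_add_left_eq_sub, ← mul_sub, abs_mul, abs_of_nonneg M.γ_nonneg]
  exact mul_le_mul_of_nonneg_left
    (FiniteMDP.abs_iSup_sub_iSup_le fun u => norm_le_pi_norm (Q - Q') (s', u)) M.γ_nonneg

theorem norm_empBellman_le (M : FiniteMDP S A) (x : ℕ → S × A × S) (k : ℕ) {Q : S × A → ℝ}
    (hQ : ‖Q‖ ≤ 1 / (1 - M.γ)) : ‖empBellman M x k Q‖ ≤ 1 / (1 - M.γ) := by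
  have h1 : 0 < 1 - M.γ := sub_pos.2 M.γ_lt_one
  have h0 : ‖empBellman M x k 0‖ ≤ 1 := by
    rw [pi_norm_le_iff_of_nonneg zero_le_one]
    rintro ⟨s, a⟩
    refine abs_visitAvg_le x k s a zero_le_one fun s' => ?_
    simpa using M.r_bound s a s'
  have h2 := empBellman_sub_le M x k Q 0
  rw [sub_zero] at h2
  have h3 := norm_sub_norm_le (empBellman M x k Q) (empBellman M x k 0)
  have h4 := mul_le_mul_of_nonneg_left hQ M.γ_nonneg
  have h5 : M.γ * (1 / (1 - M.γ)) + 1 = 1 / (1 - M.γ) := by field_simp; ring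
  linarith

/-- Each learning step is a convex combination of two points of the same ball. The error at the
start of the accurate phase is thus bounded whatever the data. -/
theorem norm_mbqIter_le (M : FiniteMDP S A) {α : ℝ} (hα : 0 ≤ α) (hα1 : α ≤ 1) (m : ℕ)
    {Q₀ : S × A → ℝ} (hQ₀ : ‖Q₀‖ ≤ 1 / (1 - M.γ)) (x : ℕ → S × A × S) (k : ℕ) :
    ‖mbqIter M α m Q₀ x k‖ ≤ 1 / (1 - M.γ) := by
  induction k with
  | zero => exact hQ₀
  | succ k ih =>
    rcases lt_or_ge k m with h | h
    · rwa [mbqIter_succ_of_lt M α Q₀ x h]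
    · rw [mbqIter_succ_of_le M α Q₀ x h]
      set Q := mbqIter M α m Q₀ x k
      have h1 : Q + α • (empBellman M x (k + 1) Q - Q)
          = (1 - α) • Q + α • empBellman M x (k + 1) Q := by
        module
      rw [h1]
      refine (norm_add_le _ _).trans ?_
      rw [norm_smul, norm_smul, Real.norm_of_nonneg hα, Real.norm_of_nonneg (sub_nonneg.2 hα1)]
      have h2 := mul_le_mul_of_nonneg_left ih (sub_nonneg.2 hα1)
      have h3 := mul_le_mul_of_nonneg_left (norm_empBellman_le M x (k + 1) ih) hα
      linarith

theorem norm_mbqIter_sub_qStar_le_two_mul (M : FiniteMDP S A) {α : ℝ} (hα : 0 ≤ α) (hα1 : α ≤ 1)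
    (m : ℕ) {Q₀ : S × A → ℝ} (hQ₀ : ‖Q₀‖ ≤ 1 / (1 - M.γ)) (x : ℕ → S × A × S) (k : ℕ) :
    ‖mbqIter M α m Q₀ x k - M.qStar‖ ≤ 2 / (1 - M.γ) := by
  have h1 := norm_mbqIter_le M hα hα1 m hQ₀ x k
  have h2 := M.norm_qStar_le
  have h3 := norm_sub_le (mbqIter M α m Q₀ x k) M.qStar
  have h4 : 2 / (1 - M.γ) = 1 / (1 - M.γ) + 1 / (1 - M.γ) := by ring
  linarith

/-- Inserting the empirical operator at `qStar` lets the contraction absorb the dependence of the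
iterate on the samples; noise remains only at a deterministic function. -/
theorem norm_mbqIter_succ_sub_qStar_le (M : FiniteMDP S A) {α : ℝ} (hα : 0 ≤ α) (hα1 : α ≤ 1)
    {m k : ℕ} (Q₀ : S × A → ℝ) (x : ℕ → S × A × S) (h : m ≤ k) {η : ℝ}
    (hη : ‖empBellman M x (k + 1) M.qStar - M.qStar‖ ≤ η) :
    ‖mbqIter M α m Q₀ x (k + 1) - M.qStar‖
      ≤ (1 - α * (1 - M.γ)) * ‖mbqIter M α m Q₀ x k - M.qStar‖ + α * η := by
  rw [mbqIter_succ_of_le M α Q₀ x h]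
  set Q := mbqIter M α m Q₀ x k
  have h1 : Q + α • (empBellman M x (k + 1) Q - Q) - M.qStar
      = (1 - α) • (Q - M.qStar)
        + α • (empBellman M x (k + 1) Q - empBellman M x (k + 1) M.qStar)
        + α • (empBellman M x (k + 1) M.qStar - M.qStar) := by
    module
  rw [h1]
  refine (norm_add₃_le).trans ?_
  rw [norm_smul, norm_smul, norm_smul, Real.norm_of_nonneg hα,
    Real.norm_of_nonneg (sub_nonneg.2 hα1)]
  have h2 := mul_le_mul_of_nonneg_left (empBellman_sub_le M x (k + 1) Q M.qStar) hα
  have h3 := mul_le_mul_of_nonneg_left hη hα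
  linarith

/-- If the empirical Bellman operator is `η`-accurate at the optimal Q-function from time `K` on,
the error decays geometrically to `η / (1 - γ)`. -/
theorem norm_mbqIter_add_sub_qStar_le (M : FiniteMDP S A) {α : ℝ} (hα : 0 ≤ α) (hα1 : α ≤ 1)
    {m K : ℕ} {Q₀ : S × A → ℝ} (hQ₀ : ‖Q₀‖ ≤ 1 / (1 - M.γ)) (x : ℕ → S × A × S) (h : m ≤ K) {η : ℝ}
    (hη : ∀ k, K ≤ k → ‖empBellman M x k M.qStar - M.qStar‖ ≤ η) (j : ℕ) :
    ‖mbqIter M α m Q₀ x (K + j) - M.qStar‖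
      ≤ (1 - α * (1 - M.γ)) ^ j * (2 / (1 - M.γ)) + η / (1 - M.γ) := by
  have h1 : 0 < 1 - M.γ := sub_pos.2 M.γ_lt_one
  have hη0 : 0 ≤ η := (norm_nonneg _).trans (hη K le_rfl)
  induction j with
  | zero =>
    rw [pow_zero, one_mul, add_zero]
    have := norm_mbqIter_sub_qStar_le_two_mul M hα hα1 m hQ₀ x K
    have : 0 ≤ η / (1 - M.γ) := by positivity
    linarith
  | succ j ih =>
    have h2 := norm_mbqIter_succ_sub_qStar_le M hα hα1 Q₀ x (h.trans (Nat.le_add_right K j))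
      (hη (K + j + 1) (by omega))
    have h3 : 0 ≤ 1 - α * (1 - M.γ) := by nlinarith [M.γ_nonneg]
    have h4 := mul_le_mul_of_nonneg_left ih h3
    -- η/(1-γ) is the fixed point of the affine error recursion.
    have h5 : (1 - α * (1 - M.γ)) * (η / (1 - M.γ)) + α * η = η / (1 - M.γ) := by
      field_simp
      ring
    rw [← add_assoc, pow_succ]
    linarith

end Iterates

/-! ### Concentration of the empirical Bellman operator -/

section Concentration

/-- Chernoff's bound with exponent 1; the free parameter is absorbed into f. -/
theorem measureReal_zero_le_sum_le_pow {Y Ω : Type*} [Fintype Y] [MeasurableSpace Y]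
    [MeasurableSingletonClass Y] [MeasurableSpace Ω] {μ : Measure Ω} [IsProbabilityMeasure μ]
    {X : ℕ → Ω → Y} (hX : ∀ k, Measurable (X k)) (hind : iIndepFun X μ) {p : Y → ℝ}
    (hlaw : ∀ k y, μ.real {ω | X k ω = y} = p y) (f : Y → ℝ) {c : ℝ}
    (hc : ∑ y, p y * Real.exp (f y) ≤ c) (k : ℕ) :
    μ.real {ω | 0 ≤ ∑ i ∈ Finset.range k, f (X i ω)} ≤ c ^ k := by
  have hf : Measurable f := measurable_of_finite f
  have hcomp : iIndepFun (fun i => f ∘ X i) μ := hind.comp (fun _ => f) fun _ => hf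
  have hmeas : ∀ i, Measurable (f ∘ X i) := fun i => hf.comp (hX i)
  have hmgf : ∀ i, mgf (f ∘ X i) μ 1 = ∑ y, p y * Real.exp (f y) := by
    intro i
    have : IsProbabilityMeasure (μ.map (X i)) := Measure.isProbabilityMeasure_map (hX i).aemeasurable
    have h1 : mgf (f ∘ X i) μ 1 = ∫ y, Real.exp (f y) ∂(μ.map (X i)) := by
      rw [integral_map (hX i).aemeasurable (measurable_of_finite _).aestronglyMeasurable]
      simp [mgf]
    rw [h1, integral_fintype Integrable.of_finite]
    refine Finset.sum_congr rfl fun y _ => ?_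
    rw [smul_eq_mul, map_measureReal_apply (hX i) (measurableSet_singleton y), ← hlaw i y]
    rfl
  have hint : Integrable (fun ω => Real.exp (1 * (∑ i ∈ Finset.range k, f ∘ X i) ω)) μ := by
    refine hcomp.integrable_exp_mul_sum hmeas fun i _ => ?_
    have : IsProbabilityMeasure (μ.map (X i)) := Measure.isProbabilityMeasure_map (hX i).aemeasurable
    exact (Integrable.of_finite (μ := μ.map (X i)) (f := fun y => Real.exp (1 * f y))).comp_measurable
      (hX i)
  have h := measure_ge_le_exp_mul_mgf (X := ∑ i ∈ Finset.range k, f ∘ X i) (μ := μ) 0 zero_le_one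
    hint
  rw [hcomp.mgf_sum hmeas] at h
  simp only [hmgf, mul_zero, Real.exp_zero, one_mul, Finset.prod_const, Finset.card_range,
    Finset.sum_apply, Function.comp_apply] at h
  refine h.trans (pow_le_pow_left₀ (Finset.sum_nonneg fun y _ => ?_) hc k)
  rw [← hlaw 0 y]
  positivity

variable {S A : Type*} [Fintype S]

/-- The Bellman residual of the optimal Q-function along the transition `(s, a, s')`. -/
noncomputable def tdError (M : FiniteMDP S A) (s : S) (a : A) (s' : S) : ℝ :=
  M.r s a s' + M.γ * (⨆ u : A, M.qStar (s', u)) - M.qStar (s, a)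

open Classical in
/-- Signed Bellman residual minus the tolerance `η`, counted at visits to `(s, a)` only. -/
noncomputable def visitExcess (M : FiniteMDP S A) (σ η : ℝ) (s : S) (a : A) (x : S × A × S) : ℝ :=
  if x.1 = s ∧ x.2.1 = a then σ * tdError M s a x.2.2 - η else 0

theorem abs_empBellman_sub_qStar_le (M : FiniteMDP S A) (x : ℕ → S × A × S) (k : ℕ) {η : ℝ} (s : S)
    (a : A) (hpos : ∑ i ∈ Finset.range k, visitExcess M 1 η s a (x i) < 0)
    (hneg : ∑ i ∈ Finset.range k, visitExcess M (-1) η s a (x i) < 0) :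
    |empBellman M x k M.qStar (s, a) - M.qStar (s, a)| ≤ η := by
  classical
  set F := (Finset.range k).filter (fun i => (x i).1 = s ∧ (x i).2.1 = a) with hF
  have hN : visitCount x k s a = F.card := by
    unfold visitCount
    congr!
  have hsum : ∀ σ, ∑ i ∈ Finset.range k, visitExcess M σ η s a (x i)
      = σ * ∑ i ∈ F, tdError M s a (x i).2.2 - F.card * η := by
    intro σ
    rw [Finset.mul_sum, ← nsmul_eq_mul, ← Finset.sum_const, ← Finset.sum_sub_distrib, hF,
      Finset.sum_filter]
    refine Finset.sum_congr rfl fun i _ => ?_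
    unfold visitExcess
    congr!
  rw [hsum] at hpos hneg
  -- Without visits the sum would be 0, so strict negativity also certifies that the pair has been
  -- visited.
  have hcard : 0 < F.card := by
    rw [Finset.card_pos, Finset.nonempty_iff_ne_empty]
    intro h
    simp [h] at hpos
  have hcard' : (0 : ℝ) < F.card := Nat.cast_pos.2 hcard
  have hdiff : empBellman M x k M.qStar (s, a) - M.qStar (s, a)
      = (∑ i ∈ F, tdError M s a (x i).2.2) / F.card := by
    rw [empBellman, visitAvg, hN]
    simp only [tdError, Finset.sum_sub_distrib, Finset.sum_const, nsmul_eq_mul]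
    rw [sub_div, mul_div_cancel_left₀ _ hcard'.ne']
  rw [hdiff, abs_div, Nat.abs_cast, div_le_iff₀ hcard', abs_le]
  constructor <;> linarith

variable [Fintype A]

theorem dMin_le (d : S × A → ℝ) (y : S × A) : dMin d ≤ d y :=
  ciInf_le (Set.finite_range d).bddBelow y

theorem card_mul_dMin_le_one {d : S × A → ℝ} (hd : IsExploratory d) :
    (Fintype.card S * Fintype.card A : ℝ) * dMin d ≤ 1 := by
  have h := Finset.sum_le_sum fun (y : S × A) (_ : y ∈ Finset.univ) => dMin_le d y
  rw [hd.sum_one, Finset.sum_const, Finset.card_univ, Fintype.card_prod, nsmul_eq_mul] at h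
  exact_mod_cast h

variable [Nonempty A]

/-- The Bellman optimality equation, read as centring of the residual. -/
theorem sum_P_mul_tdError (M : FiniteMDP S A) (s : S) (a : A) :
    ∑ s', M.P s a s' * tdError M s a s' = 0 := by
  have h := congrFun M.bellman_qStar (s, a)
  simp only [FiniteMDP.bellman] at h
  simp only [tdError, mul_sub, Finset.sum_sub_distrib, h, ← Finset.sum_mul, M.P_sum]
  ring

theorem abs_tdError_le (M : FiniteMDP S A) (s : S) (a : A) (s' : S) :
    |tdError M s a s'| ≤ 2 / (1 - M.γ) := by
  have h1 : 0 < 1 - M.γ := sub_pos.2 M.γ_lt_one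
  have hQ : ∀ y, |M.qStar y| ≤ 1 / (1 - M.γ) := fun y => (norm_le_pi_norm _ y).trans M.norm_qStar_le
  have hV : |⨆ u : A, M.qStar (s', u)| ≤ 1 / (1 - M.γ) := by
    obtain ⟨u, hu⟩ := exists_eq_ciSup_of_finite (f := fun u : A => M.qStar (s', u))
    rw [← hu]
    exact hQ _
  have h2 : |M.γ * ⨆ u : A, M.qStar (s', u)| ≤ M.γ * (1 / (1 - M.γ)) := by
    rw [abs_mul, abs_of_nonneg M.γ_nonneg]
    exact mul_le_mul_of_nonneg_left hV M.γ_nonneg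
  have h3 := abs_sub (M.r s a s' + M.γ * ⨆ u : A, M.qStar (s', u)) (M.qStar (s, a))
  have h4 := abs_add_le (M.r s a s') (M.γ * ⨆ u : A, M.qStar (s', u))
  have h5 : 1 + M.γ * (1 / (1 - M.γ)) + 1 / (1 - M.γ) = 2 / (1 - M.γ) := by field_simp; ring
  have h6 := hQ (s, a)
  have h7 := M.r_bound s a s'
  unfold tdError
  linarith

/-- A sample off the pair contributes the factor 1. A visit contributes, by exp t ≤ 1 + t + t² and
centring, at most 1 - η²(1-γ)²/36 on average. This treats the random visit count and the residuals
together. -/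
theorem sum_mul_exp_visitExcess_le (M : FiniteMDP S A) (d : S × A → ℝ) (hd : ∀ y, 0 ≤ d y)
    (hd1 : ∑ y, d y = 1) {σ η : ℝ} (hσ : |σ| ≤ 1) (hη : 0 ≤ η) (hη1 : η ≤ 1) (s : S) (a : A) :
    ∑ y : S × A × S, d (y.1, y.2.1) * M.P y.1 y.2.1 y.2.2
        * Real.exp (η * (1 - M.γ) ^ 2 / 18 * visitExcess M σ η s a y)
      ≤ 1 - d (s, a) * (η ^ 2 * (1 - M.γ) ^ 2 / 36) := by
  classical
  have hβ : 0 < 1 - M.γ := sub_pos.2 M.γ_lt_one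
  have hβ1 : 1 - M.γ ≤ 1 := by linarith [M.γ_nonneg]
  set β := 1 - M.γ
  -- The minimizer of -lη + l²(3/β)², where 3/β bounds the excess; the negative drift is then twice
  -- the quadratic term.
  set l := η * β ^ 2 / 18 with hl
  have hl0 : 0 ≤ l := by positivity
  have hpt : ∀ s', Real.exp (l * (σ * tdError M s a s' - η))
      ≤ 1 + (l * σ * tdError M s a s' - η ^ 2 * β ^ 2 / 36) := by
    intro s'
    set t := σ * tdError M s a s' - η with ht
    have h1 : |t| ≤ 3 / β := by
      have e1 : |σ * tdError M s a s'| ≤ 2 / β := by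
        rw [abs_mul]
        exact (mul_le_of_le_one_left (abs_nonneg _) hσ).trans (abs_tdError_le M s a s')
      have e2 := abs_sub (σ * tdError M s a s') η
      have e3 : η ≤ 1 / β := hη1.trans ((le_div_iff₀ hβ).2 (by linarith))
      have e4 : 3 / β = 2 / β + 1 / β := by ring
      rw [abs_of_nonneg hη] at e2
      linarith
    have h2 : |l * t| ≤ 1 := by
      rw [abs_mul, abs_of_nonneg hl0]
      calc l * |t| ≤ l * (3 / β) := mul_le_mul_of_nonneg_left h1 hl0
        _ = η * β / 6 := by rw [hl]; field_simp; ring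
        _ ≤ 1 := by nlinarith
    have h3 := (abs_le.1 (Real.abs_exp_sub_one_sub_id_le h2)).2
    have h4 : (l * t) ^ 2 ≤ η ^ 2 * β ^ 2 / 36 := by
      calc (l * t) ^ 2 = l ^ 2 * |t| ^ 2 := by rw [mul_pow, sq_abs]
        _ ≤ l ^ 2 * (3 / β) ^ 2 :=
          mul_le_mul_of_nonneg_left (pow_le_pow_left₀ (abs_nonneg _) h1 2) (sq_nonneg _)
        _ = η ^ 2 * β ^ 2 / 36 := by rw [hl]; field_simp; ring
    have h5 : l * t = l * σ * tdError M s a s' - 2 * (η ^ 2 * β ^ 2 / 36) := by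
      rw [ht, hl]; ring
    linarith
  have hrow : ∀ s₁ a₁, ∑ s', d (s₁, a₁) * M.P s₁ a₁ s'
      * Real.exp (l * visitExcess M σ η s a (s₁, a₁, s'))
      ≤ d (s₁, a₁) - if (s₁, a₁) = (s, a) then d (s, a) * (η ^ 2 * β ^ 2 / 36) else 0 := by
    intro s₁ a₁
    by_cases h : s₁ = s ∧ a₁ = a
    · obtain ⟨rfl, rfl⟩ := h
      simp only [visitExcess, and_self, if_true]
      calc _ ≤ ∑ s', d (s₁, a₁) * M.P s₁ a₁ s'
            * (1 + (l * σ * tdError M s₁ a₁ s' - η ^ 2 * β ^ 2 / 36)) :=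
          Finset.sum_le_sum fun s' _ => mul_le_mul_of_nonneg_left (hpt s')
            (mul_nonneg (hd _) (M.P_nonneg _ _ _))
        _ = d (s₁, a₁) * (1 - η ^ 2 * β ^ 2 / 36) * ∑ s', M.P s₁ a₁ s'
            + d (s₁, a₁) * (l * σ) * ∑ s', M.P s₁ a₁ s' * tdError M s₁ a₁ s' := by
          rw [Finset.mul_sum, Finset.mul_sum, ← Finset.sum_add_distrib]
          exact Finset.sum_congr rfl fun s' _ => by ring
        _ ≤ _ := by
          rw [sum_P_mul_tdError, M.P_sum]
          exact le_of_eq (by ring)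
    · have h' : (s₁, a₁) ≠ (s, a) := fun e => h (Prod.ext_iff.1 e)
      simp only [visitExcess, h, h', if_false, mul_zero, Real.exp_zero, mul_one, sub_zero]
      rw [← Finset.mul_sum, M.P_sum, mul_one]
  have htot : 1 - d (s, a) * (η ^ 2 * β ^ 2 / 36) = ∑ y : S × A,
      (d y - if y = (s, a) then d (s, a) * (η ^ 2 * β ^ 2 / 36) else 0) := by
    rw [Finset.sum_sub_distrib, hd1, Finset.sum_ite_eq' Finset.univ (s, a)]
    simp
  rw [htot, Fintype.sum_prod_type, Fintype.sum_prod_type]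
  refine Finset.sum_le_sum fun s₁ _ => ?_
  rw [Fintype.sum_prod_type]
  exact Finset.sum_le_sum fun a₁ _ => hrow s₁ a₁

theorem dMin_pos [Nonempty S] {d : S × A → ℝ} (hd : IsExploratory d) : 0 < dMin d := by
  obtain ⟨y, hy⟩ := exists_eq_ciInf_of_finite (f := d)
  rw [dMin, ← hy]
  exact hd.pos y

/-- With high probability the empirical Bellman operator is accurate at the optimal Q-function at
all times after `K`. -/
theorem one_sub_le_measureReal_empBellman [Nonempty S] {Ω : Type*} [MeasurableSpace S]
    [MeasurableSingletonClass S] [MeasurableSpace A] [MeasurableSingletonClass A]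
    [MeasurableSpace Ω] {μ : Measure Ω} [IsProbabilityMeasure μ] {M : FiniteMDP S A}
    {d : S × A → ℝ} {X : ℕ → Ω → S × A × S} (hd : IsExploratory d) (hX : IsSampleStream M d μ X)
    {η ρ δ : ℝ} (hη : 0 < η) (hη1 : η ≤ 1) (hρ : ρ = dMin d * (η ^ 2 * (1 - M.γ) ^ 2 / 36))
    {K : ℕ} (hK : 2 * (Fintype.card S * Fintype.card A : ℝ) * ((1 - ρ) ^ K / ρ) ≤ δ) :
    1 - δ ≤ μ.real {ω | ∀ k, K ≤ k →
      ‖empBellman M (fun i => X i ω) k M.qStar - M.qStar‖ ≤ η} := by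
  have hβ : 0 < 1 - M.γ := sub_pos.2 M.γ_lt_one
  have hβ1 : 1 - M.γ ≤ 1 := by linarith [M.γ_nonneg]
  have hmin := dMin_pos hd
  have hρ0 : 0 < ρ := by rw [hρ]; positivity
  have hcard : (1 : ℝ) ≤ Fintype.card S * Fintype.card A := by
    exact_mod_cast Nat.mul_pos (Fintype.card_pos (α := S)) (Fintype.card_pos (α := A))
  have hmin1 : dMin d ≤ 1 := by nlinarith [card_mul_dMin_le_one hd]
  have hρ1 : ρ < 1 := by
    have h1 : η ^ 2 * (1 - M.γ) ^ 2 / 36 ≤ 1 / 36 := by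
      have := mul_le_mul (pow_le_one₀ hη.le hη1 (n := 2)) (pow_le_one₀ hβ.le hβ1 (n := 2))
        (sq_nonneg _) zero_le_one
      linarith
    have h2 := mul_le_mul hmin1 h1 (by positivity) zero_le_one
    linarith
  let bad (k : ℕ) (y : S × A) (σ : ℝ) : Set Ω :=
    {ω | 0 ≤ ∑ i ∈ Finset.range k, visitExcess M σ η y.1 y.2 (X i ω)}
  have hbad : ∀ k y σ, |σ| ≤ 1 → μ.real (bad k y σ) ≤ (1 - ρ) ^ k := by
    intro k y σ hσ
    have hl : 0 < η * (1 - M.γ) ^ 2 / 18 := by positivity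
    -- A positive factor does not change the event, but it installs the Chernoff parameter.
    have h1 : bad k y σ = {ω | 0 ≤ ∑ i ∈ Finset.range k,
        η * (1 - M.γ) ^ 2 / 18 * visitExcess M σ η y.1 y.2 (X i ω)} := by
      ext ω
      simp only [bad, Set.mem_ofPred_eq, ← Finset.mul_sum]
      rw [mul_nonneg_iff_of_pos_left hl]
    rw [h1]
    refine measureReal_zero_le_sum_le_pow hX.measurable hX.indep
      (p := fun y => d (y.1, y.2.1) * M.P y.1 y.2.1 y.2.2) (fun k y => hX.law k y.1 y.2.1 y.2.2)
      (fun x => η * (1 - M.γ) ^ 2 / 18 * visitExcess M σ η y.1 y.2 x) ?_ k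
    refine (sum_mul_exp_visitExcess_le M d (fun y => (hd.pos y).le) hd.sum_one hσ hη.le hη1
      y.1 y.2).trans ?_
    rw [hρ]
    have := mul_le_mul_of_nonneg_right (dMin_le d y)
      (show 0 ≤ η ^ 2 * (1 - M.γ) ^ 2 / 36 by positivity)
    linarith
  let Bad (k : ℕ) : Set Ω := ⋃ y : S × A, (bad k y 1 ∪ bad k y (-1))
  have hBad : ∀ k, μ.real (Bad k) ≤ 2 * (Fintype.card S * Fintype.card A : ℝ) * (1 - ρ) ^ k := by
    intro k
    refine (measureReal_iUnion_fintype_le _).trans ?_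
    have : ∀ y : S × A, μ.real (bad k y 1 ∪ bad k y (-1)) ≤ 2 * (1 - ρ) ^ k := fun y => by
      have h1 := hbad k y 1 (by simp)
      have h2 := hbad k y (-1) (by simp)
      have h3 := measureReal_union_le (μ := μ) (bad k y 1) (bad k y (-1))
      linarith
    refine (Finset.sum_le_sum fun y _ => this y).trans (le_of_eq ?_)
    rw [Finset.sum_const, Finset.card_univ, Fintype.card_prod, nsmul_eq_mul]
    push_cast
    ring
  -- Uniformity over all later times costs only the factor 1/ρ of a geometric series.
  have hU : μ.real (⋃ j, Bad (K + j)) ≤ δ := by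
    have hs : HasSum (fun j : ℕ => 2 * (Fintype.card S * Fintype.card A : ℝ) * (1 - ρ) ^ (K + j))
        (2 * (Fintype.card S * Fintype.card A : ℝ) * ((1 - ρ) ^ K / ρ)) := by
      have h := (hasSum_geometric_of_lt_one (sub_nonneg.2 hρ1.le) (by linarith : 1 - ρ < 1)).mul_left
        (2 * (Fintype.card S * Fintype.card A : ℝ) * (1 - ρ) ^ K)
      rw [sub_sub_cancel] at h
      have e : (fun j : ℕ => 2 * (Fintype.card S * Fintype.card A : ℝ) * (1 - ρ) ^ (K + j))
          = fun j => 2 * (Fintype.card S * Fintype.card A : ℝ) * (1 - ρ) ^ K * (1 - ρ) ^ j := by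
        funext j
        rw [pow_add]
        ring
      rw [e, ← mul_div_assoc, div_eq_mul_inv]
      exact h
    have hnn : ∀ j : ℕ, 0 ≤ 2 * (Fintype.card S * Fintype.card A : ℝ) * (1 - ρ) ^ (K + j) :=
      fun j => mul_nonneg (by positivity) (pow_nonneg (sub_nonneg.2 hρ1.le) _)
    refine ENNReal.toReal_le_of_le_ofReal ((hs.nonneg hnn).trans hK) ?_
    calc μ (⋃ j, Bad (K + j)) ≤ ∑' j, μ (Bad (K + j)) := measure_iUnion_le _
      _ ≤ ∑' j, ENNReal.ofReal (2 * (Fintype.card S * Fintype.card A : ℝ) * (1 - ρ) ^ (K + j)) :=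
        ENNReal.tsum_le_tsum fun j => by
          rw [← ofReal_measureReal]
          exact ENNReal.ofReal_le_ofReal (hBad _)
      _ = ENNReal.ofReal (2 * (Fintype.card S * Fintype.card A : ℝ) * ((1 - ρ) ^ K / ρ)) := by
        rw [← ENNReal.ofReal_tsum_of_nonneg hnn hs.summable, hs.tsum_eq]
      _ ≤ ENNReal.ofReal δ := ENNReal.ofReal_le_ofReal hK
  have hsub : (⋃ j, Bad (K + j))ᶜ ⊆ {ω | ∀ k, K ≤ k →
      ‖empBellman M (fun i => X i ω) k M.qStar - M.qStar‖ ≤ η} := by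
    intro ω hω k hk
    rw [pi_norm_le_iff_of_nonneg hη.le]
    rintro ⟨s, a⟩
    have hω' : ω ∉ Bad k := fun h => hω (Set.mem_iUnion.2 ⟨k - K, by rwa [Nat.add_sub_cancel' hk]⟩)
    simp only [Bad, bad, Set.mem_iUnion, Set.mem_union, Set.mem_ofPred_eq, not_exists, not_or,
      not_le] at hω'
    exact abs_empBellman_sub_qStar_le M _ k s a (hω' (s, a)).1 (hω' (s, a)).2
  have h1 := measureReal_mono (μ := μ) hsub
  have h2 := measureReal_union_le (μ := μ) (⋃ j, Bad (K + j)) (⋃ j, Bad (K + j))ᶜ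
  rw [Set.union_compl_self, probReal_univ] at h2
  linarith

end Concentration

/-! ### Choice of constants and the sample complexity bound -/

section UpperBound

theorem exp_neg_natCast_mul_log {x : ℝ} (hx : 0 < x) (n : ℕ) :
    Real.exp (-(n * Real.log x)) = (x ^ n)⁻¹ := by
  rw [Real.exp_neg, Real.exp_nat_mul, Real.exp_log hx]

theorem one_sub_pow_le_inv_pow {x y : ℝ} (hx : x ≤ 1) (hy : 0 < y) {n k : ℕ}
    (h : n * Real.log y ≤ x * k) : (1 - x) ^ k ≤ (y ^ n)⁻¹ := by
  rw [← exp_neg_natCast_mul_log hy]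
  calc (1 - x) ^ k ≤ Real.exp (-x) ^ k :=
        pow_le_pow_left₀ (sub_nonneg.2 hx) (by linarith [Real.add_one_le_exp (-x)]) k
    _ = Real.exp (-(x * k)) := by rw [← Real.exp_nat_mul]; ring_nf
    _ ≤ _ := Real.exp_le_exp.2 (neg_le_neg h)

theorem four_mul_le_two_add_pow {x : ℝ} (hx : 0 ≤ x) : 4 * x ≤ (2 + x) ^ 3 := by
  nlinarith [pow_nonneg hx 3, sq_nonneg x]

/-- With Y = 1/(Dδβ²ε), the target is 2/(Dρδ) = 288 Y²δ. Of the eleven factors 2 + Y, nine absorb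
288 ≤ 2⁹ and two absorb Y². -/
theorem geometric_tail_le {D β ε δ ρ N : ℝ} {K : ℕ} (hD : 0 < D) (hβ : 0 < β) (hε : 0 < ε)
    (hδ : 0 < δ) (hδ1 : δ ≤ 1) (hND : N ≤ 1 / D) (hρ : ρ = D * β ^ 4 * ε ^ 2 / 144) (hρ1 : ρ ≤ 1)
    (hK : 11 * Real.log (2 + 1 / (D * δ * β ^ 2 * ε)) ≤ ρ * K) :
    2 * N * ((1 - ρ) ^ K / ρ) ≤ δ := by
  have hρ0 : 0 < ρ := by rw [hρ]; positivity
  have e1 : 2 / (D * ρ * δ) = 288 * (1 / (D * δ * β ^ 2 * ε)) ^ 2 * δ := by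
    rw [hρ]
    field_simp
    norm_num
  have hY0 : 0 < 1 / (D * δ * β ^ 2 * ε) := by positivity
  set Y := 1 / (D * δ * β ^ 2 * ε)
  have h1 : (1 - ρ) ^ K ≤ ((2 + Y) ^ 11)⁻¹ :=
    one_sub_pow_le_inv_pow hρ1 (by linarith) (by exact_mod_cast hK)
  have h2 : 2 / (D * ρ * δ) ≤ (2 + Y) ^ 11 := by
    have e2 : 288 * Y ^ 2 * δ ≤ 288 * Y ^ 2 := mul_le_of_le_one_right (by positivity) hδ1
    have e3 : (2 : ℝ) ^ 9 ≤ (2 + Y) ^ 9 := pow_le_pow_left₀ two_pos.le (by linarith) 9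
    have e4 : Y ^ 2 ≤ (2 + Y) ^ 2 := pow_le_pow_left₀ hY0.le (by linarith) 2
    have e5 := mul_le_mul e3 e4 (sq_nonneg _) (by positivity)
    rw [← pow_add] at e5
    norm_num at e5
    linarith [sq_nonneg Y]
  have h3 : 2 * N * ((1 - ρ) ^ K / ρ) ≤ 2 * (1 / D) * (((2 + Y) ^ 11)⁻¹ / ρ) := by
    have : 0 ≤ (1 - ρ) ^ K := pow_nonneg (by linarith) K
    gcongr
  refine h3.trans ?_
  rw [div_le_iff₀ (by positivity)] at h2
  rw [show 2 * (1 / D) * (((2 + Y) ^ 11)⁻¹ / ρ) = 2 / (D * ρ * (2 + Y) ^ 11) by field_simp,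
    div_le_iff₀ (by positivity)]
  linarith

/-- Used to show that data collection ends before the accurate phase begins. Since εβ < 2, the
argument 2N/δ is at most four times 1/(Dδβ²ε). -/
theorem log_two_mul_div_le {D β ε δ N : ℝ} (hD : 0 < D) (hβ : 0 < β) (hβ1 : β ≤ 1) (hε : 0 < ε)
    (hεβ : ε * β < 2) (hδ : 0 < δ) (hN : 0 < N) (hND : N ≤ 1 / D) :
    Real.log (2 * N / δ) ≤ 3 * Real.log (2 + 1 / (D * δ * β ^ 2 * ε)) := by
  have hY0 : 0 < 1 / (D * δ * β ^ 2 * ε) := by positivity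
  have e1 : D * δ * β ^ 2 * ε ≤ 2 * (D * δ) := by
    have : β ^ 2 * ε ≤ 2 := by nlinarith
    nlinarith [mul_pos hD hδ]
  have e2 : 1 / (2 * (D * δ)) ≤ 1 / (D * δ * β ^ 2 * ε) :=
    one_div_le_one_div_of_le (by positivity) e1
  have e3 : 2 * N / δ ≤ 2 * (1 / D) / δ := by gcongr
  have e4 : 2 * (1 / D) / δ = 4 * (1 / (2 * (D * δ))) := by field_simp; norm_num
  have e5 := four_mul_le_two_add_pow hY0.le
  have h := Real.log_le_log (by positivity)
    (show 2 * N / δ ≤ (2 + 1 / (D * δ * β ^ 2 * ε)) ^ 3 by linarith)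
  rwa [Real.log_pow, Nat.cast_ofNat] at h

theorem initial_error_le {α D β ε δ : ℝ} {j : ℕ} (hα1 : α ≤ 1) (hD : 0 < D)
    (hD1 : D ≤ 1) (hβ : 0 < β) (hβ1 : β ≤ 1) (hε : 0 < ε) (hδ : 0 < δ) (hδ1 : δ ≤ 1)
    (hj : 3 * Real.log (2 + 1 / (D * δ * β ^ 2 * ε)) ≤ α * β * j) :
    (1 - α * β) ^ j * (2 / β) ≤ ε / 2 := by
  have hY0 : 0 < 1 / (D * δ * β ^ 2 * ε) := by positivity
  have e1 : D * δ * β ^ 2 * ε ≤ β * ε := by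
    have f1 : D * δ * β ≤ 1 := mul_le_one₀ (mul_le_one₀ hD1 hδ.le hδ1) hβ.le hβ1
    nlinarith [mul_pos hβ hε]
  have e2 : 1 / (β * ε) ≤ 1 / (D * δ * β ^ 2 * ε) := one_div_le_one_div_of_le (by positivity) e1
  set Y := 1 / (D * δ * β ^ 2 * ε)
  have hpow : (1 - α * β) ^ j ≤ ((2 + Y) ^ 3)⁻¹ :=
    one_sub_pow_le_inv_pow (mul_le_one₀ hα1 hβ.le hβ1) (by linarith) (by exact_mod_cast hj)
  have hY3 : 4 / (β * ε) ≤ (2 + Y) ^ 3 := by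
    have e3 : 4 / (β * ε) = 4 * (1 / (β * ε)) := by ring
    linarith [four_mul_le_two_add_pow hY0.le]
  refine (mul_le_mul_of_nonneg_right hpow (by positivity)).trans ?_
  rw [div_le_iff₀ (by positivity)] at hY3
  rw [inv_mul_le_iff₀ (by positivity), div_le_iff₀ hβ]
  linarith

variable {S A Ω : Type*} [Fintype S] [Fintype A] [Nonempty S] [Nonempty A]

theorem one_sub_le_measureReal_mbqIter [MeasurableSpace S] [MeasurableSingletonClass S]
    [MeasurableSpace A] [MeasurableSingletonClass A] [MeasurableSpace Ω] {μ : Measure Ω}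
    [IsProbabilityMeasure μ] (M : FiniteMDP S A) {α ε δ : ℝ} {Q₀ : S × A → ℝ} (hα : 0 < α)
    (hα1 : α ≤ 1) (hε : 0 < ε) (hδ : 0 < δ) (hδ1 : δ < 1) (hQ₀ : ‖Q₀‖ ≤ 1 / (1 - M.γ))
    (hεγ : ε < 2 / (1 - M.γ)) {d : S × A → ℝ} {X : ℕ → Ω → S × A × S} (hd : IsExploratory d)
    (hX : IsSampleStream M d μ X) :
    1 - δ ≤ μ.real {ω | ∀ k : ℕ,
      2000 * (1 / (dMin d * (1 - M.γ) ^ 4 * ε ^ 2) + 1 / (α * (1 - M.γ)))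
          * Real.log (2 + 1 / (dMin d * δ * (1 - M.γ) ^ 2 * ε)) ≤ (k : ℝ) →
        ‖mbqIter M α (collectLen d δ) Q₀ (fun i => X i ω) k - M.qStar‖ ≤ ε} := by
  have hβ : 0 < 1 - M.γ := sub_pos.2 M.γ_lt_one
  have hβ1 : 1 - M.γ ≤ 1 := by linarith [M.γ_nonneg]
  have hD := dMin_pos hd
  have hcard0 : (1 : ℝ) ≤ Fintype.card S * Fintype.card A := by
    exact_mod_cast Nat.mul_pos (Fintype.card_pos (α := S)) (Fintype.card_pos (α := A))
  have hcardD := card_mul_dMin_le_one hd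
  have hcollect : collectLen d δ
    = ⌈1 / dMin d * Real.log (2 * (Fintype.card S * Fintype.card A : ℝ) / δ)⌉₊ := rfl
  set β := 1 - M.γ with hβdef
  set D := dMin d with hDdef
  set N := (Fintype.card S * Fintype.card A : ℝ) with hN
  set Y := 1 / (D * δ * β ^ 2 * ε) with hY
  set L := Real.log (2 + Y) with hL
  have hY0 : 0 < Y := by positivity
  have hND : N ≤ 1 / D := (le_div_iff₀ hD).2 hcardD
  have hD1 : D ≤ 1 := by nlinarith
  have hεβ : ε * β < 2 := (lt_div_iff₀ hβ).1 hεγ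
  have hL2 : 1 / 2 ≤ L := by
    have h1 := Real.log_le_log two_pos (show (2 : ℝ) ≤ 2 + Y by linarith)
    have h2 := Real.log_two_gt_d9
    linarith
  have hL0 : 0 ≤ L := by linarith
  -- The stationary error η/β is then ε/2, leaving ε/2 for the initial error.
  set η := β * ε / 2 with hη
  have hη0 : 0 < η := by positivity
  have hη1 : η ≤ 1 := by rw [hη]; linarith
  set ρ := D * (η ^ 2 * β ^ 2 / 36) with hρ
  have hρ0 : 0 < ρ := by positivity
  have hρD : ρ ≤ D / 36 := by
    have : η ^ 2 * β ^ 2 ≤ 1 := mul_le_one₀ (pow_le_one₀ hη0.le hη1) (sq_nonneg _)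
      (pow_le_one₀ hβ.le hβ1)
    rw [hρ]
    nlinarith
  have hG : 1 / (D * β ^ 4 * ε ^ 2) = 1 / (144 * ρ) := by
    rw [hρ, hη]
    congr 1
    ring
  set K := ⌈11 * L / ρ⌉₊ with hKdef
  have hρeq : ρ = D * β ^ 4 * ε ^ 2 / 144 := by rw [hρ, hη]; ring
  have hK : 2 * N * ((1 - ρ) ^ K / ρ) ≤ δ := by
    refine geometric_tail_le hD hβ hε hδ hδ1.le hND hρeq (by linarith) ?_
    have := (div_le_iff₀ hρ0).1 (Nat.le_ceil (11 * L / ρ))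
    linarith
  have hmK : collectLen d δ ≤ K := by
    rw [hcollect, hKdef]
    refine Nat.ceil_le_ceil ?_
    have h2 : Real.log (2 * N / δ) ≤ 3 * L :=
      log_two_mul_div_le hD hβ hβ1 hε hεβ hδ (by linarith) hND
    have h3 : 1 / D ≤ 1 / ρ := one_div_le_one_div_of_le hρ0 (by linarith)
    calc 1 / D * Real.log (2 * N / δ) ≤ 1 / D * (3 * L) :=
          mul_le_mul_of_nonneg_left h2 (by positivity)
      _ ≤ 1 / ρ * (11 * L) := mul_le_mul h3 (by linarith) (by linarith) (by positivity)
      _ = 11 * L / ρ := by ring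
  refine (one_sub_le_measureReal_empBellman hd hX hη0 hη1 hρ hK).trans (measureReal_mono ?_)
  intro ω hω k hk
  have hLρ : 1 ≤ L / ρ := (one_le_div hρ0).2 (by linarith)
  have hKle : (K : ℝ) ≤ 11 * (L / ρ) + 1 := by
    rw [← mul_div_assoc]
    exact (Nat.ceil_lt_add_one (by positivity)).le
  -- As L/ρ ≥ 1, K is at most 12 L/ρ, and 2000/144 > 12 pays for it. The second summand is left for
  -- the j contracting steps.
  have hk' : 2000 / 144 * (L / ρ) + 2000 * (L / (α * β)) ≤ k := by
    refine le_trans (le_of_eq ?_) hk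
    rw [hG]
    field_simp
  have hLαβ : 0 ≤ L / (α * β) := by positivity
  obtain ⟨j, rfl⟩ := Nat.exists_eq_add_of_le
    (show K ≤ k by exact_mod_cast (by linarith : (K : ℝ) ≤ k))
  have hj : 2000 * (L / (α * β)) ≤ j := by
    push_cast at hk'
    linarith
  have hmain := norm_mbqIter_add_sub_qStar_le M hα.le hα1 hQ₀ (fun i => X i ω) hmK hω j
  rw [← hβdef] at hmain
  have hη2 : η / β = ε / 2 := by rw [hη]; field_simp
  have hinit : (1 - α * β) ^ j * (2 / β) ≤ ε / 2 := by
    refine initial_error_le hα1 hD hD1 hβ hβ1 hε hδ hδ1.le ?_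
    rw [← mul_div_assoc, div_le_iff₀ (by positivity)] at hj
    refine le_trans ?_ (hj.trans_eq (mul_comm _ _))
    exact mul_le_mul_of_nonneg_right (by norm_num) hL0
  rw [hη2] at hmain
  linarith

theorem dMin_unifDist : dMin (unifDist S A) = 1 / (Fintype.card S * Fintype.card A : ℝ) := by
  simp [dMin, unifDist]

theorem isExploratory_unifDist : IsExploratory (unifDist S A) where
  pos y := by
    have := Fintype.card_pos (α := S)
    have := Fintype.card_pos (α := A)
    unfold unifDist
    positivity
  sum_one := by
    simp only [unifDist, Finset.sum_const, Finset.card_univ, Fintype.card_prod, nsmul_eq_mul,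
      Nat.cast_mul]
    rw [mul_one_div, div_self (by positivity)]

end UpperBound

theorem exists_upper_bound : ∃ C : ℝ, 0 < C ∧
    ∀ (S A Ω : Type*) [Fintype S] [Fintype A] [Nonempty S] [Nonempty A]
      [MeasurableSpace S] [MeasurableSingletonClass S]
      [MeasurableSpace A] [MeasurableSingletonClass A] [MeasurableSpace Ω]
      (μ : Measure Ω) [IsProbabilityMeasure μ] (M : FiniteMDP S A)
      (α ε δ : ℝ) (Q₀ : S × A → ℝ),
      0 < α → α ≤ 1 → 0 < ε → 0 < δ → δ < 1 → ‖Q₀‖ ≤ 1 / (1 - M.γ) →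
      (∀ (d : S × A → ℝ) (X : ℕ → Ω → S × A × S),
        IsExploratory d → IsSampleStream M d μ X →
        1 - δ ≤ μ.real {ω | ∀ k : ℕ,
          C * (1 / (dMin d * (1 - M.γ) ^ 4 * ε ^ 2) + 1 / (α * (1 - M.γ)))
              * Real.log (2 + 1 / (dMin d * δ * (1 - M.γ) ^ 2 * ε)) ≤ (k : ℝ) →
            ‖mbqIter M α (collectLen d δ) Q₀ (fun i => X i ω) k - M.qStar‖ ≤ ε}) ∧
      (∀ X : ℕ → Ω → S × A × S, IsSampleStream M (unifDist S A) μ X →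
        1 - δ ≤ μ.real {ω | ∀ k : ℕ,
          C / α * ((Fintype.card S * Fintype.card A : ℝ) / ((1 - M.γ) ^ 4 * ε ^ 2))
              * Real.log (2 + (Fintype.card S * Fintype.card A : ℝ)
                  / (δ * (1 - M.γ) ^ 2 * ε)) ≤ (k : ℝ) →
            ‖mbqIter M α (collectLen (unifDist S A) δ) Q₀ (fun i => X i ω) k - M.qStar‖
              ≤ ε}) := by
  -- 10000 = 5 · 2000: under uniform sampling the term 1/(α(1-γ)) is at most four times the main
  -- term.
  refine ⟨10000, by norm_num, ?_⟩
  intro S A Ω _ _ _ _ _ _ _ _ _ μ _ M α ε δ Q₀ hα hα1 hε hδ hδ1 hQ₀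
  have hβ : 0 < 1 - M.γ := sub_pos.2 M.γ_lt_one
  have hβ1 : 1 - M.γ ≤ 1 := by linarith [M.γ_nonneg]
  -- For such large ε every iterate is within ε already; otherwise ε(1-γ) < 2, which makes η ≤ 1.
  rcases le_or_gt (2 / (1 - M.γ)) ε with hεγ | hεγ
  · have htriv : ∀ (m : ℕ) (X : ℕ → Ω → S × A × S) (T : ℝ), 1 - δ ≤ μ.real {ω | ∀ k : ℕ,
        T ≤ (k : ℝ) → ‖mbqIter M α m Q₀ (fun i => X i ω) k - M.qStar‖ ≤ ε} := by
      intro m X T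
      have huniv : {ω | ∀ k : ℕ, T ≤ (k : ℝ) →
          ‖mbqIter M α m Q₀ (fun i => X i ω) k - M.qStar‖ ≤ ε} = Set.univ :=
        Set.eq_univ_of_forall fun ω k _ =>
          (norm_mbqIter_sub_qStar_le_two_mul M hα.le hα1 m hQ₀ (fun i => X i ω) k).trans hεγ
      rw [huniv, probReal_univ]
      linarith
    exact ⟨fun d X _ _ => htriv _ X _, fun X _ => htriv _ X _⟩
  · constructor
    · intro d X hd hX
      refine (one_sub_le_measureReal_mbqIter M hα hα1 hε hδ hδ1 hQ₀ hεγ hd hX).trans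
        (measureReal_mono fun ω hω k hk => hω k (le_trans ?_ hk))
      have hD := dMin_pos hd
      have hlog : 0 ≤ Real.log (2 + 1 / (dMin d * δ * (1 - M.γ) ^ 2 * ε)) :=
        Real.log_nonneg (by
          have : 0 ≤ 1 / (dMin d * δ * (1 - M.γ) ^ 2 * ε) := by positivity
          linarith)
      gcongr
      norm_num
    · intro X hX
      refine (one_sub_le_measureReal_mbqIter M hα hα1 hε hδ hδ1 hQ₀ hεγ isExploratory_unifDist
        hX).trans (measureReal_mono fun ω hω k hk => hω k (le_trans ?_ hk))
      have hN : (1 : ℝ) ≤ Fintype.card S * Fintype.card A := by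
        exact_mod_cast Nat.mul_pos (Fintype.card_pos (α := S)) (Fintype.card_pos (α := A))
      rw [dMin_unifDist]
      set N := (Fintype.card S * Fintype.card A : ℝ)
      set β := 1 - M.γ
      have hN0 : 0 < N := by linarith
      have e1 : 1 / (1 / N * δ * β ^ 2 * ε) = N / (δ * β ^ 2 * ε) := by field_simp
      rw [e1]
      have hlog : 0 ≤ Real.log (2 + N / (δ * β ^ 2 * ε)) :=
        Real.log_nonneg (by
          have : 0 ≤ N / (δ * β ^ 2 * ε) := by positivity
          linarith)
      refine mul_le_mul_of_nonneg_right ?_ hlog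
      have hεβ : ε * β < 2 := (lt_div_iff₀ hβ).1 hεγ
      have e2 : 1 / (1 / N * β ^ 4 * ε ^ 2) = N / (β ^ 4 * ε ^ 2) := by field_simp
      have e3 : N / (β ^ 4 * ε ^ 2) ≤ 1 / α * (N / (β ^ 4 * ε ^ 2)) :=
        le_mul_of_one_le_left (by positivity) ((one_le_div hα).2 hα1)
      -- Follows from β⁴ε² = (εβ)²β² ≤ 4β and N ≥ 1.
      have e4 : 1 / (α * β) ≤ 4 * (1 / α * (N / (β ^ 4 * ε ^ 2))) := by
        have f1 : 1 / β ≤ 4 * (N / (β ^ 4 * ε ^ 2)) := by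
          rw [← mul_div_assoc, div_le_div_iff₀ hβ (by positivity)]
          have g1 : (ε * β) ^ 2 ≤ 4 := by nlinarith [mul_pos hε hβ]
          have g2 : β ^ 2 ≤ β := by nlinarith
          have g3 := mul_le_mul g1 g2 (sq_nonneg _) (by norm_num)
          nlinarith
        have f2 := mul_le_mul_of_nonneg_left f1 (show 0 ≤ 1 / α by positivity)
        have f3 : 1 / (α * β) = 1 / α * (1 / β) := by field_simp
        linarith
      have e5 : 10000 / α * (N / (β ^ 4 * ε ^ 2)) = 10000 * (1 / α * (N / (β ^ 4 * ε ^ 2))) := by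
        ring
      rw [e2, e5]
      linarith
theorem mainTheorem1 :
    -- Upper bounds, with one universal constant.
    (∃ C : ℝ, 0 < C ∧
      ∀ (S A Ω : Type*) [Fintype S] [Fintype A] [Nonempty S] [Nonempty A]
        [MeasurableSpace S] [MeasurableSingletonClass S]
        [MeasurableSpace A] [MeasurableSingletonClass A] [MeasurableSpace Ω]
        (μ : Measure Ω) [IsProbabilityMeasure μ] (M : FiniteMDP S A)
        (α ε δ : ℝ) (Q₀ : S × A → ℝ),
        0 < α → α ≤ 1 → 0 < ε → 0 < δ → δ < 1 → ‖Q₀‖ ≤ 1 / (1 - M.γ) →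
        -- any exploratory sampling distribution
        (∀ (d : S × A → ℝ) (X : ℕ → Ω → S × A × S),
          IsExploratory d → IsSampleStream M d μ X →
          1 - δ ≤ μ.real {ω | ∀ k : ℕ,
            C * (1 / (dMin d * (1 - M.γ) ^ 4 * ε ^ 2) + 1 / (α * (1 - M.γ)))
                * Real.log (2 + 1 / (dMin d * δ * (1 - M.γ) ^ 2 * ε)) ≤ (k : ℝ) →
              ‖mbqIter M α (collectLen d δ) Q₀ (fun i => X i ω) k - M.qStar‖ ≤ ε}) ∧
        -- the uniform sampling distribution
        (∀ X : ℕ → Ω → S × A × S, IsSampleStream M (unifDist S A) μ X →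
          1 - δ ≤ μ.real {ω | ∀ k : ℕ,
            C / α * ((Fintype.card S * Fintype.card A : ℝ) / ((1 - M.γ) ^ 4 * ε ^ 2))
                * Real.log (2 + (Fintype.card S * Fintype.card A : ℝ)
                    / (δ * (1 - M.γ) ^ 2 * ε)) ≤ (k : ℝ) →
              ‖mbqIter M α (collectLen (unifDist S A) δ) Q₀ (fun i => X i ω) k - M.qStar‖
                ≤ ε})) ∧
    -- Lower bound for every estimator that uses uniform samples, even with known rewards.
    (∃ c : ℝ, 0 < c ∧
      ∀ (S A : Type*) [Fintype S] [Fintype A] [Nonempty A] (γ ε δ : ℝ),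
        2 ≤ Fintype.card S → 1 / 2 ≤ γ → γ < 1 → 0 < ε → ε ≤ c / (1 - γ) →
        0 < δ → δ ≤ 1 / 8 →
        ∃ r : S → A → S → ℝ, (∀ s a s', |r s a s'| ≤ 1) ∧
          ∀ (n : ℕ) (est : (Fin n → S × A × S) → ProbabilityMeasure (S × A → ℝ)),
            (∀ M : FiniteMDP S A, M.r = r → M.γ = γ →
              1 - δ ≤ successProb M (unifDist S A) n est ε) →
            c * ((Fintype.card S * Fintype.card A : ℝ) / ((1 - γ) ^ 3 * ε ^ 2))
                * Real.log (1 / δ) ≤ (n : ℝ)) :=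
  ⟨exists_upper_bound, exists_lower_bound⟩
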